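/- Let $m_1,m_2>0$. Consider three bodies in $\mathbb R^3$ with positions $x(t),y(t),z(t)$, masses $m_1,m_2,m_2$ and gravitational constant $1$, moving without collision for all $t\in\mathbb R$ according to $$\ddot x=\tfrac{m_2}{|y-x|^3}(y-x)+\tfrac{m_2}{|z-x|^3}(z-x),\quad \ddot y=\tfrac{m_1}{|x-y|^3}(x-y)+\tfrac{m_2}{|z-y|^3}(z-y),\quad \ddot z=\tfrac{m_1}{|x-z|^3}(x-z)+\tfrac{m_2}{|y-z|^3}(y-z).$$ Let $\mathbb B$ be the set of all such solutions $(x,y,z)$ for which there are real numbers $y_{10}>0$, $dy_{20}$, $df_0$ with $$x(0)=(0,0,0),\quad y(0)=(y_{10},0,0),\quad z(0)=(-y_{10},0,0),$$ $$\dot x(0)=(0,0,df_0),\quad \dot y(0)=\bigl(0,dy_{20},-\tfrac{m_1\,df_0}{2m_2}\bigr),\quad \dot z(0)=\bigl(0,-dy_{20},-\tfrac{m_1\,df_0}{2m_2}\bigr)$$ (so that $r=\sqrt{y_1^2+y_2^2}$ satisfies $\dot r(0)=0$), and such that the constants $$c_1=y_{10}\,dy_{20},\qquad c_2=m_2\,dy_{20}^2-\tfrac{m_2}{2y_{10}}(4m_1+m_2)+\tfrac{m_1}{4m_2}(m_1+2m_2)\,df_0^2$$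 (the angular momentum per unit mass of the body $y$ about the vertical axis, and the total energy) satisfy $$c_1\neq 0,\qquad c_2<0,\qquad 8m_1m_2^2+m_2^3+16\,c_2c_1^2<0 .$$ Theorem. For all $m_1,m_2>0$, the family $\mathbb B$ contains infinitely many solutions that are periodic (there is $T>0$ with $x(t+T)=x(t)$, $y(t+T)=y(t)$, $z(t+T)=z(t)$ for all $t$) and non-trivial, meaning that the third coordinate $f$ of $x=(0,0,f)$ is not identically zero. -/

import Mathlib

namespace ThreeBody

/-- Physical space `ℝ³` with its Euclidean norm. -/
abbrev Space : Type := EuclideanSpace ℝ (Fin 3)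

/-- A triple of trajectories `(x, y, z)`, one for each body, defined for all times. -/
abbrev Motion : Type := (ℝ → Space) × (ℝ → Space) × (ℝ → Space)

/-- The acceleration that a body of mass `m` at the point `b` gives to a body at the point `a`
(the gravitational constant is `1`). -/
noncomputable def pull (m : ℝ) (a b : Space) : Space :=
  (m / ‖b - a‖ ^ 3) • (b - a)

/-- `u` is twice differentiable at `t` with second derivative `a`. -/
def HasAccelAt (u : ℝ → Space) (a : Space) (t : ℝ) : Prop :=
  DifferentiableAt ℝ u t ∧ HasDerivAt (deriv u) a t

/-- `x, y, z` is a collision-free solution, for all times, of Newton's equations for three bodies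
with masses `m₁, m₂, m₂`. -/
def IsSolution (m₁ m₂ : ℝ) (x y z : ℝ → Space) : Prop :=
  ∀ t : ℝ,
    (x t ≠ y t ∧ x t ≠ z t ∧ y t ≠ z t) ∧
    HasAccelAt x (pull m₂ (x t) (y t) + pull m₂ (x t) (z t)) t ∧
    HasAccelAt y (pull m₁ (y t) (x t) + pull m₂ (y t) (z t)) t ∧
    HasAccelAt z (pull m₁ (z t) (x t) + pull m₂ (z t) (y t)) t

/-- The initial positions and velocities with parameters `y₁₀ = a`, `dy₂₀ = v`, `df₀ = w`.
The distance `r` of `y` to the vertical axis satisfies `r(0) = |a|` and, for `a ≠ 0`,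
`r'(0) = 0`. -/
def HasInitialData (m₁ m₂ a v w : ℝ) (x y z : ℝ → Space) : Prop :=
  x 0 = !₂[0, 0, 0] ∧ y 0 = !₂[a, 0, 0] ∧ z 0 = !₂[-a, 0, 0] ∧
  deriv x 0 = !₂[0, 0, w] ∧
  deriv y 0 = !₂[0, v, -(m₁ * w / (2 * m₂))] ∧
  deriv z 0 = !₂[0, -v, -(m₁ * w / (2 * m₂))]

/-- The constant angular momentum `c₁` per unit mass of the body `y`, from the initial data. -/
def c₁ (a v : ℝ) : ℝ := a * v

/-- The total energy `c₂`, from the initial data (for `a > 0`). -/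
noncomputable def c₂ (m₁ m₂ a v w : ℝ) : ℝ :=
  m₂ * v ^ 2 - m₂ / (2 * a) * (4 * m₁ + m₂) + m₁ / (4 * m₂) * (m₁ + 2 * m₂) * w ^ 2

/-- The family `𝔹` for the masses `m₁, m₂, m₂`. -/
def familyB (m₁ m₂ : ℝ) : Set Motion :=
  {p | IsSolution m₁ m₂ p.1 p.2.1 p.2.2 ∧
    ∃ a v w : ℝ, 0 < a ∧ HasInitialData m₁ m₂ a v w p.1 p.2.1 p.2.2 ∧
      c₁ a v ≠ 0 ∧ c₂ m₁ m₂ a v w < 0 ∧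
      8 * m₁ * m₂ ^ 2 + m₂ ^ 3 + 16 * c₂ m₁ m₂ a v w * c₁ a v ^ 2 < 0}

/-- The motion is periodic: the three bodies return to their positions after a common period. -/
def IsPeriodic (p : Motion) : Prop :=
  ∃ T : ℝ, 0 < T ∧ Function.Periodic p.1 T ∧ Function.Periodic p.2.1 T ∧
    Function.Periodic p.2.2 T

/-- The height `f` of the body `x` is not identically zero. -/
def IsNontrivial (p : Motion) : Prop :=
  ∃ t : ℝ, p.1 t 2 ≠ 0

end ThreeBody

/-! Let r be the distance of `y` from the axis and h the height of `x` above the pair. Take the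
rotation angle θ as independent variable and write r = μ²/q, h/r = εu. With β = m₂/(4m₁ + m₂) and S
= `shape (ε * u)`, Newton's equations become q'' = -q + β + (1 - β)S and u'' = -u - uβ(8S - 1)/q; μ²
is only a length scale. At ε = 0 they are explicit: q = 1 + e cos θ, and u solves the linear
equation u'' + (1 + 7β/(1 + e cos θ))u = 0.

The equations are reversible. An orbit with q' = u = 0 at angle 0 and again at angle Θ makes q and u
periodic with period 2Θ (`periodic_of_reversal`), and the motion in space is periodic once Θ is also
a rational multiple of π. For e > 0 the zero kπ of q' = -e sin θ is simple, so it persists as a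
continuous Θ(e, ε), and it remains to solve G(e, ε) = u(Θ) = 0 with Θ in πℚ. If G changes sign
between two values of e, its zeros separate two sides of a thin rectangle, reaching from ε = 0,
where Θ = kπ, to the top; the value of Θ - kπ there either vanishes or is reached only through
rational multiples of π. `exists_zero_rational` turns this into a planar intermediate value theorem.

The sign change is found at ε = 0 (`exists_sign_change`). A Prüfer angle of u advances at the mean
rate √(1 + 7β) for e = 0 and at a strictly larger rate for e = m (`weight_comparison`,
`sqrt_lt_weightFreq_mul`). Over kπ with k large the two phases differ by at least 2π, so u(kπ) takes
both signs for 0 < e ≤ m.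

Finally, the inequalities defining the family reduce to conditions on e and ε alone
(`energy_bound`), so one reduced orbit yields a motion for every μ > 0; these rescalings are the
infinitely many solutions. -/

namespace ThreeBody

open Set Filter Topology
open scoped NNReal

/-! ### Global flows of bounded Lipschitz vector fields. -/

section Flow

variable {E : Type*} [NormedAddCommGroup E] [NormedSpace ℝ E]

/-- A bounded Lipschitz vector field has a global integral curve through every point. -/
theorem exists_global_solution [CompleteSpace E] {F : E → E} {K L : ℝ≥0} (hF : LipschitzWith K F)
    (hL : ∀ x, ‖F x‖ ≤ L) (x : E) :
    ∃ γ : ℝ → E, γ 0 = x ∧ ∀ t, HasDerivAt γ (F (γ t)) t := by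
  have key : ∀ n : ℕ, ∃ γ : ℝ → E, γ 0 = x ∧
      ∀ t ∈ Ioo (-((n : ℝ) + 1)) (n + 1), HasDerivAt γ (F (γ t)) t := by
    intro n
    have h0 : (0 : ℝ) ∈ Icc (-((n : ℝ) + 1)) (n + 1) := ⟨by linarith [n.cast_nonneg (α := ℝ)],
      by positivity⟩
    -- In time `n + 1` at speed at most `L` a curve stays within `L * (n + 1)`, so this radius
    -- imposes no restriction on the interval.
    have hpl : IsPicardLindelof (fun _ => F) (⟨0, h0⟩ : Icc (-((n : ℝ) + 1)) (n + 1)) x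
        (L * (n + 1)) 0 L K := by
      refine ⟨fun t _ => hF.lipschitzOnWith, fun y _ => continuousOn_const,
        fun t _ y _ => hL y, ?_⟩
      simp
    obtain ⟨γ, hγ0, hγ⟩ := hpl.exists_eq_forall_mem_Icc_hasDerivWithinAt₀
    exact ⟨γ, hγ0, fun t ht => (hγ t (Ioo_subset_Icc_self ht)).hasDerivAt
      (Icc_mem_nhds ht.1 ht.2)⟩
  choose γ hγ0 hγ using key
  have hmono : ∀ m n : ℕ, m ≤ n → ∀ t ∈ Ioo (-((m : ℝ) + 1)) (m + 1), γ m t = γ n t := by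
    intro m n hmn t ht
    have hmn' : (m : ℝ) ≤ n := by exact_mod_cast hmn
    have hm0 : (0 : ℝ) ≤ m := m.cast_nonneg
    refine ODE_solution_unique_of_mem_Ioo (v := fun _ => F) (s := fun _ => univ) (K := K)
      (t₀ := 0) (a := -((m : ℝ) + 1)) (b := m + 1)
      (fun _ _ => hF.lipschitzOnWith) ⟨by linarith, by linarith⟩
      (fun s hs => ⟨hγ m s hs, trivial⟩)
      (fun s hs => ⟨hγ n s ⟨by linarith [hs.1], by linarith [hs.2]⟩, trivial⟩) ?_ ht
    rw [hγ0, hγ0]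
  have hmem : ∀ t : ℝ, t ∈ Ioo (-((⌊|t|⌋₊ : ℝ) + 1)) (⌊|t|⌋₊ + 1) := fun t =>
    abs_lt.1 (Nat.lt_floor_add_one |t|)
  have hcomm : ∀ (m n : ℕ) (t : ℝ), t ∈ Ioo (-((m : ℝ) + 1)) (m + 1) →
      t ∈ Ioo (-((n : ℝ) + 1)) (n + 1) → γ m t = γ n t := by
    intro m n t hm hn
    rcases le_total m n with h | h
    · exact hmono m n h t hm
    · exact (hmono n m h t hn).symm
  refine ⟨fun t => γ ⌊|t|⌋₊ t, by simp [hγ0], fun t => ?_⟩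
  refine (hγ ⌊|t|⌋₊ t (hmem t)).congr_of_eventuallyEq ?_
  filter_upwards [Ioo_mem_nhds (hmem t).1 (hmem t).2] with s hs
  exact hcomm _ _ s (hmem s) hs

/-- Two integral curves of a Lipschitz vector field separate at most exponentially. -/
theorem dist_solution_le {F : E → E} {K : ℝ≥0} (hF : LipschitzWith K F) {γ δ : ℝ → E}
    (hγ : ∀ t, HasDerivAt γ (F (γ t)) t) (hδ : ∀ t, HasDerivAt δ (F (δ t)) t) (t : ℝ) :
    dist (γ t) (δ t) ≤ dist (γ 0) (δ 0) * Real.exp (K * |t|) := by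
  have pos : ∀ (G : E → E), LipschitzWith K G → ∀ γ δ : ℝ → E,
      (∀ t, HasDerivAt γ (G (γ t)) t) → (∀ t, HasDerivAt δ (G (δ t)) t) → ∀ t, 0 ≤ t →
      dist (γ t) (δ t) ≤ dist (γ 0) (δ 0) * Real.exp (K * t) := by
    intro G hG γ δ hγ hδ t ht
    have := dist_le_of_trajectories_ODE (v := fun _ => G) (K := K) (f := γ) (g := δ) (a := 0)
      (b := t) (fun _ => hG) (fun s _ => (hγ s).continuousAt.continuousWithinAt)
      (fun s _ => (hγ s).hasDerivWithinAt) (fun s _ => (hδ s).continuousAt.continuousWithinAt)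
      (fun s _ => (hδ s).hasDerivWithinAt) le_rfl t ⟨ht, le_rfl⟩
    simpa using this
  rcases le_total 0 t with ht | ht
  · rw [abs_of_nonneg ht]; exact pos F hF γ δ hγ hδ t ht
  · have hrev : ∀ η : ℝ → E, (∀ t, HasDerivAt η (F (η t)) t) →
        ∀ t, HasDerivAt (fun s => η (-s)) ((fun x => -F x) (η (-t))) t := by
      intro η hη s
      simpa [Function.comp_def] using (hη (-s)).scomp s (hasDerivAt_neg s)
    have hneg : LipschitzWith K fun x => -F x := hF.neg
    have := pos _ hneg _ _ (hrev γ hγ) (hrev δ hδ) (-t) (by linarith)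
    simpa [abs_of_nonpos ht] using this

theorem solution_unique {F : E → E} {K : ℝ≥0} (hF : LipschitzWith K F) {γ δ : ℝ → E}
    (hγ : ∀ t, HasDerivAt γ (F (γ t)) t) (hδ : ∀ t, HasDerivAt δ (F (δ t)) t)
    (h0 : γ 0 = δ 0) : γ = δ := by
  funext t
  have := dist_solution_le hF hγ hδ t
  rw [h0, dist_self, zero_mul] at this
  exact dist_le_zero.1 this

/-- A bounded Lipschitz vector field has a global continuous flow. -/
theorem exists_flow [CompleteSpace E] {F : E → E} {K L : ℝ≥0} (hF : LipschitzWith K F) (hL : ∀ x, ‖F x‖ ≤ L) :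
    ∃ φ : E → ℝ → E, (∀ x, φ x 0 = x) ∧ (∀ x t, HasDerivAt (φ x) (F (φ x t)) t) ∧
      Continuous fun z : E × ℝ => φ z.1 z.2 := by
  choose φ h0 hφ using exists_global_solution hF hL
  refine ⟨φ, h0, hφ, ?_⟩
  rw [continuous_iff_continuousAt]
  rintro ⟨x, t⟩
  have hlim : Tendsto (fun z : E × ℝ => dist z.1 x * Real.exp (K * |z.2|) +
      dist (φ x z.2) (φ x t)) (𝓝 (x, t)) (𝓝 0) := by
    have hc : Continuous (φ x) := continuous_iff_continuousAt.2 fun s => (hφ x s).continuousAt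
    have : Continuous fun z : E × ℝ => dist z.1 x * Real.exp (K * |z.2|) +
      dist (φ x z.2) (φ x t) := by fun_prop
    simpa using this.tendsto (x, t)
  refine tendsto_iff_dist_tendsto_zero.2 (squeeze_zero (fun _ => dist_nonneg) ?_ hlim)
  rintro ⟨y, s⟩
  refine (dist_triangle _ (φ x s) _).trans (add_le_add ?_ le_rfl)
  simpa [h0] using dist_solution_le hF (hφ y) (hφ x) s

end Flow

/-! ### Continuous logarithms and zeros of planar maps. -/

section Lift

/-- A normed space is contractible, hence simply connected. The imaginary part of `L` serves as a
winding angle in the planar zero theorem and as the Prüfer phase. -/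
theorem exists_continuous_log {X : Type*} [NormedAddCommGroup X] [NormedSpace ℝ X] {f : X → ℂ} (hf : Continuous f) (h0 : ∀ x, f x ≠ 0) :
    ∃ L : X → ℂ, Continuous L ∧ ∀ x, Complex.exp (L x) = f x := by
  have hu : IsSimplyConnected (univ : Set X) := by
    have : ContractibleSpace (univ : Set X) := convex_univ.contractibleSpace univ_nonempty
    exact SimplyConnectedSpace.ofContractible _
  obtain ⟨L, hL, hexp⟩ := Complex.exists_continuousOn_eqOn_exp_comp hu
    isOpen_univ hf.continuousOn (by simpa using h0)
  exact ⟨L, by simpa [continuousOn_univ] using hL, fun x => hexp (mem_univ x)⟩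

/-- A continuous logarithm of a differentiable function is differentiable. -/
theorem hasDerivAt_of_exp_eq {L f : ℝ → ℂ} {f' : ℂ} {t : ℝ} (hL : ContinuousAt L t)
    (hexp : ∀ s, Complex.exp (L s) = f s) (hf : HasDerivAt f f' t) :
    HasDerivAt L (f' / f t) t := by
  have hne : f t ≠ 0 := by rw [← hexp]; exact Complex.exp_ne_zero _
  have h1 : HasDerivAt (fun s => f s / f t) (f' / f t) t := hf.div_const _
  have h2 : HasDerivAt (fun s => Complex.log (f s / f t)) (f' / f t) t := by
    have := h1.clog_real (by simp [div_self hne])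
    simpa [div_self hne] using this
  have h3 : HasDerivAt (fun s => L t + Complex.log (f s / f t)) (f' / f t) t :=
    h2.const_add _
  refine h3.congr_of_eventuallyEq ?_
  -- Near `t` the increment of `L` lies in the strip where the principal logarithm inverts `exp`.
  have hb : ∀ᶠ s in 𝓝 t, |(L s - L t).im| < Real.pi := by
    have : ContinuousAt (fun s => |(L s - L t).im|) t := by fun_prop
    refine this.eventually_lt continuousAt_const ?_
    simp [Real.pi_pos]
  filter_upwards [hb] with s hs
  rw [← hexp s, ← hexp t, ← Complex.exp_sub, Complex.log_exp (by linarith [(abs_lt.1 hs).1])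
    (abs_lt.1 hs).2.le]
  ring

theorem lt_of_lt_of_forall_ne {b : ℝ → ℝ} (hb : Continuous b) {c : ℝ} (hc : ∀ s, b s ≠ c)
    {p : ℝ} (hp : b p < c) (q : ℝ) : b q < c := by
  by_contra! h
  obtain ⟨s, hs⟩ := mem_range_of_exists_le_of_exists_ge hb ⟨p, hp.le⟩ ⟨q, h⟩
  exact hc s hs

theorem gt_of_gt_of_forall_ne {b : ℝ → ℝ} (hb : Continuous b) {c : ℝ} (hc : ∀ s, b s ≠ c)
    {p : ℝ} (hp : c < b p) (q : ℝ) : c < b q := by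
  by_contra! h
  obtain ⟨s, hs⟩ := mem_range_of_exists_le_of_exists_ge hb ⟨q, h⟩ ⟨p, hp.le⟩
  exact hc s hs

/-- A planar version of the intermediate value theorem: a continuous map of a rectangle whose
real part changes sign from left to right and whose imaginary part changes sign from the bottom to
the zeros of the real part on the top, has a zero. -/
theorem exists_zero_of_sign_change {d : ℝ} (hd : 0 ≤ d) {f : ℝ × ℝ → ℂ}
    (hf : ContinuousOn f (Icc 0 1 ×ˢ Icc 0 d))
    (hleft : ∀ y ∈ Icc 0 d, (f (0, y)).re < 0) (hright : ∀ y ∈ Icc 0 d, 0 < (f (1, y)).re)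
    (hbot : ∀ x ∈ Icc (0 : ℝ) 1, (f (x, 0)).im < 0)
    (htop : ∀ x ∈ Icc (0 : ℝ) 1, (f (x, d)).re = 0 → 0 < (f (x, d)).im) :
    ∃ z ∈ (Icc 0 1 ×ˢ Icc 0 d : Set (ℝ × ℝ)), f z = 0 := by
  by_contra! hne
  -- Retracting the plane onto the rectangle extends `f` without zeros to a whole vector space.
  set P : ℝ → ℝ := fun x => projIcc 0 1 zero_le_one x
  set Q : ℝ → ℝ := fun y => projIcc 0 d hd y
  have hPm : ∀ x, P x ∈ Icc (0 : ℝ) 1 := fun x => (projIcc 0 1 zero_le_one x).2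
  have hQm : ∀ x, Q x ∈ Icc (0 : ℝ) d := fun x => (projIcc 0 d hd x).2
  have hP0 : P 0 = 0 := by simp [P]
  have hP1 : P 1 = 1 := by simp [P]
  have hQ0 : Q 0 = 0 := by simp [Q]
  have hQd : Q d = d := by simp [Q]
  have hPc : Continuous P := continuous_subtype_val.comp continuous_projIcc
  have hQc : Continuous Q := continuous_subtype_val.comp continuous_projIcc
  obtain ⟨L, hL, hexp⟩ := exists_continuous_log (f := fun z : ℝ × ℝ => f (P z.1, Q z.2))
    (hf.comp_continuous (by fun_prop) fun z => ⟨hPm _, hQm _⟩)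
    (fun z => hne _ ⟨hPm _, hQm _⟩)
  have hre : ∀ z : ℝ × ℝ, (f (P z.1, Q z.2)).re =
      Real.exp (L z).re * Real.cos (L z).im := fun z => by
    rw [← hexp z, Complex.exp_re]
  have him : ∀ z : ℝ × ℝ, (f (P z.1, Q z.2)).im =
      Real.exp (L z).re * Real.sin (L z).im := fun z => by
    rw [← hexp z, Complex.exp_im]
  have hcos1 : ∀ y, 0 < Real.cos (L (1, y)).im := fun y => by
    have h := hright (Q y) (hQm y)
    have h' := hre (1, y)
    simp only [hP1] at h'
    rw [h'] at h
    exact pos_of_mul_pos_right h (Real.exp_pos _).le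
  have hcos0 : ∀ y, Real.cos (L (0, y)).im < 0 := fun y => by
    have h := hleft (Q y) (hQm y)
    have h' := hre (0, y)
    simp only [hP0] at h'
    rw [h'] at h
    exact (pos_iff_neg_of_mul_neg h).1 (Real.exp_pos _)
  have hsin0 : ∀ x, Real.sin (L (x, 0)).im < 0 := fun x => by
    have h := hbot (P x) (hPm x)
    have h' := him (x, 0)
    simp only [hQ0] at h'
    rw [h'] at h
    exact (pos_iff_neg_of_mul_neg h).1 (Real.exp_pos _)
  have hsind : ∀ x, Real.cos (L (x, d)).im = 0 → 0 < Real.sin (L (x, d)).im := fun x hx => by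
    have h := htop (P x) (hPm x)
    have h' := him (x, d)
    have h'' := hre (x, d)
    simp only [hQd] at h' h''
    rw [h', h'', hx, mul_zero] at h
    exact pos_of_mul_pos_right (h rfl) (Real.exp_pos _).le
  -- The branch of the argument is fixed at the corner `(1, d)`. Each side then forbids certain
  -- values of the argument.
  obtain ⟨n, hn1, hn2⟩ : ∃ n : ℤ, -Real.pi ≤ (L (1, d)).im - n * (2 * Real.pi) ∧
      (L (1, d)).im - n * (2 * Real.pi) < Real.pi := by
    refine ⟨toIcoDiv Real.two_pi_pos (-Real.pi) (L (1, d)).im, ?_⟩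
    have := sub_toIcoDiv_zsmul_mem_Ico Real.two_pi_pos (-Real.pi) (L (1, d)).im
    rw [zsmul_eq_mul] at this
    exact ⟨this.1, by linarith [this.2]⟩
  set a : ℝ × ℝ → ℝ := fun z => (L z).im - n * (2 * Real.pi) with ha
  have hcosa : ∀ z, Real.cos (a z) = Real.cos (L z).im := fun z => Real.cos_sub_int_mul_two_pi _ _
  have hsina : ∀ z, Real.sin (a z) = Real.sin (L z).im := fun z => Real.sin_sub_int_mul_two_pi _ _
  have hac : Continuous a := by fun_prop
  have hpi := Real.pi_pos
  have h1 : ∀ y, a (1, y) ≠ Real.pi / 2 := fun y h => by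
    have := hcos1 y; rw [← hcosa, h, Real.cos_pi_div_two] at this; exact this.false
  have h2 : ∀ y, a (1, y) ≠ -(Real.pi / 2) := fun y h => by
    have := hcos1 y; rw [← hcosa, h, Real.cos_neg, Real.cos_pi_div_two] at this; exact this.false
  have h3 : ∀ x, a (x, 0) ≠ 0 := fun y h => by
    have := hsin0 y; rw [← hsina, h, Real.sin_zero] at this; exact this.false
  have h4 : ∀ x, a (x, 0) ≠ -Real.pi := fun y h => by
    have := hsin0 y; rw [← hsina, h, Real.sin_neg, Real.sin_pi, neg_zero] at this; exact this.false
  have h5 : ∀ y, a (0, y) ≠ -(Real.pi / 2) := fun y h => by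
    have := hcos0 y; rw [← hcosa, h, Real.cos_neg, Real.cos_pi_div_two] at this; exact this.false
  have h6 : ∀ x, a (x, d) ≠ -(Real.pi / 2) := fun y h => by
    have h' := hsind y
    rw [← hcosa, ← hsina, h, Real.cos_neg, Real.cos_pi_div_two, Real.sin_neg,
      Real.sin_pi_div_two] at h'
    linarith [h' rfl]
  have hd1 : -(Real.pi / 2) < a (1, d) ∧ a (1, d) < Real.pi / 2 := by
    have hc := hcos1 d
    rw [← hcosa] at hc
    constructor
    · by_contra! h
      have := Real.cos_nonpos_of_pi_div_two_le_of_le (x := -a (1, d)) (by linarith)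
        (by simp only [ha]; linarith)
      rw [Real.cos_neg] at this; linarith
    · by_contra! h
      have := Real.cos_nonpos_of_pi_div_two_le_of_le (x := a (1, d)) (by linarith)
        (by simp only [ha]; linarith)
      linarith
  -- Following the right, bottom and left sides brings the argument at `(0, d)` below `-π/2`, while
  -- the top side keeps it above.
  have e1 : -(Real.pi / 2) < a (1, 0) :=
    gt_of_gt_of_forall_ne (b := fun y => a (1, y)) (by fun_prop) h2 hd1.1 0
  have e2 : a (1, 0) < Real.pi / 2 :=
    lt_of_lt_of_forall_ne (b := fun y => a (1, y)) (by fun_prop) h1 hd1.2 0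
  have e3 : a (1, 0) < 0 := by
    by_contra! h
    have := Real.sin_nonneg_of_nonneg_of_le_pi h (by linarith)
    rw [hsina] at this
    linarith [hsin0 1]
  have e4 : a (0, 0) < 0 :=
    lt_of_lt_of_forall_ne (b := fun x => a (x, 0)) (by fun_prop) h3 e3 0
  have e6 : a (0, 0) < -(Real.pi / 2) := by
    by_contra! h
    have := Real.cos_nonneg_of_neg_pi_div_two_le_of_le (x := a (0, 0)) (by linarith) (by linarith)
    rw [hcosa] at this
    linarith [hcos0 0]
  have e7 : a (0, d) < -(Real.pi / 2) :=
    lt_of_lt_of_forall_ne (b := fun y => a (0, y)) (by fun_prop) h5 e6 d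
  have e8 : -(Real.pi / 2) < a (0, d) :=
    gt_of_gt_of_forall_ne (b := fun x => a (x, d)) (by fun_prop) h6 hd1.1 0
  linarith

/-- If `G` changes sign from left to right of a rectangle and `H` vanishes on its bottom,
then `G` has a zero off the bottom where `H` is a rational multiple of `π`. -/
theorem exists_zero_rational {d : ℝ} (hd : 0 < d) {G H : ℝ × ℝ → ℝ}
    (hG : ContinuousOn G (Icc 0 1 ×ˢ Icc 0 d)) (hH : ContinuousOn H (Icc 0 1 ×ˢ Icc 0 d))
    (hleft : ∀ y ∈ Icc 0 d, G (0, y) < 0) (hright : ∀ y ∈ Icc 0 d, 0 < G (1, y))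
    (hbot : ∀ x ∈ Icc (0 : ℝ) 1, H (x, 0) = 0) :
    ∃ x ∈ Icc (0 : ℝ) 1, ∃ y ∈ Ioc 0 d, G (x, y) = 0 ∧ ∃ r : ℚ, H (x, y) = r * Real.pi := by
  by_contra! hno
  have hpi := Real.pi_pos
  have hdd : d ∈ Icc 0 d := ⟨hd.le, le_rfl⟩
  set B : Set ℝ := {x ∈ Icc (0 : ℝ) 1 | G (x, d) = 0} with hB
  have hBc : IsCompact B := by
    have hc : ContinuousOn (fun x => G (x, d)) (Icc (0 : ℝ) 1) :=
      hG.comp (by fun_prop) fun x hx => ⟨hx, hdd⟩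
    have : B = Icc (0 : ℝ) 1 ∩ (fun x => G (x, d)) ⁻¹' {0} := rfl
    rw [this]
    exact isCompact_Icc.of_isClosed_subset (hc.preimage_isClosed_of_isClosed isClosed_Icc
      isClosed_singleton) inter_subset_left
  obtain ⟨δ, hδ, hδB⟩ : ∃ δ > 0, ∀ x ∈ B, δ ≤ |H (x, d)| := by
    rcases B.eq_empty_or_nonempty with h | h
    · exact ⟨1, one_pos, by simp [h]⟩
    · have hc : ContinuousOn (fun x => |H (x, d)|) B :=
        (hH.comp (f := fun x : ℝ => (x, d)) (by fun_prop)
          fun x (hx : x ∈ B) => ⟨hx.1, hdd⟩).abs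
      obtain ⟨x, hx, hmin⟩ := hBc.exists_isMinOn h hc
      refine ⟨|H (x, d)|, abs_pos.2 fun h0 => ?_, fun y hy => hmin hy⟩
      exact hno x hx.1 d ⟨hd, le_rfl⟩ hx.2 0 (by simp [h0])
  -- The level `q * π` lies strictly between the value 0 of `|H|` on the bottom and its values at
  -- the zeros of `G` on the top, so `G + i(|H| - qπ)` has the required signs.
  obtain ⟨q, hq0, hqδ⟩ := exists_rat_btwn (show (0 : ℝ) < δ / Real.pi by positivity)
  have hq0' : (0 : ℝ) < q * Real.pi := by positivity
  have hqδ' : q * Real.pi < δ := (lt_div_iff₀ hpi).1 hqδ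
  obtain ⟨⟨x, y⟩, ⟨hx, hy⟩, hz⟩ := exists_zero_of_sign_change hd.le
    (f := fun z => (G z : ℂ) + ((|H z| - q * Real.pi : ℝ) : ℂ) * Complex.I)
    (by
      have hH' : ContinuousOn (fun z => |H z| - q * Real.pi) (Icc 0 1 ×ˢ Icc 0 d) :=
        hH.abs.sub continuousOn_const
      exact (Complex.continuous_ofReal.comp_continuousOn hG).add
        ((Complex.continuous_ofReal.comp_continuousOn hH').mul continuousOn_const))
    (fun y hy => by simpa using hleft y hy) (fun y hy => by simpa using hright y hy)
    (fun x hx => by simp [hbot x hx, hq0'])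
    (fun x hx h0 => by
      have h0' : G (x, d) = 0 := by simpa using h0
      have := hδB x ⟨hx, h0'⟩
      simp
      linarith)
  have hzG : G (x, y) = 0 := by simpa using congrArg Complex.re hz
  have hzH : |H (x, y)| = q * Real.pi := by
    have : |H (x, y)| - q * Real.pi = 0 := by simpa using congrArg Complex.im hz
    linarith
  have hy0 : y ≠ 0 := by
    rintro rfl
    rw [hbot x hx, abs_zero] at hzH
    linarith
  have hy' : y ∈ Ioc 0 d := ⟨lt_of_le_of_ne hy.1 (Ne.symm hy0), hy.2⟩
  rcases abs_choice (H (x, y)) with h | h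
  · exact hno x hx y hy' hzG q (by rw [← hzH, h])
  · exact hno x hx y hy' hzG (-q) (by push_cast; linarith)

end Lift

/-! ### The reduced equations, their truncation and their symmetry. -/

/-- A continuous function that is positive on a compact slice is positive on nearby slices. -/
theorem exists_forall_pos_of_pos {X : Type*} [TopologicalSpace X] {K : Set X} (hK : IsCompact K)
    {f : X → ℝ → ℝ} (hf : Continuous fun z : X × ℝ => f z.1 z.2) (h0 : ∀ x ∈ K, 0 < f x 0) :
    ∃ d > 0, ∀ y ∈ Icc 0 d, ∀ x ∈ K, 0 < f x y := by
  have : ∀ᶠ y in 𝓝 (0 : ℝ), ∀ x ∈ K, 0 < f x y := by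
    refine hK.eventually_forall_of_forall_eventually fun x hx => ?_
    have hc : Continuous fun z : ℝ × X => f z.2 z.1 := hf.comp continuous_swap
    exact (hc.tendsto (0, x)).eventually_const_lt (h0 x hx)
  obtain ⟨d, hd, h⟩ := Metric.eventually_nhds_iff.1 this
  refine ⟨d / 2, by positivity, fun y hy x hx => h ?_ x hx⟩
  rw [Real.dist_eq, sub_zero, abs_of_nonneg hy.1]
  linarith [hy.2]

/-- The factor `(1 + U²)^(-3/2)` of the attraction between the vertical body and the pair. -/
noncomputable def shape (U : ℝ) : ℝ := 1 / √(1 + U ^ 2) ^ 3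

theorem sqrt_one_add_sq_pos (U : ℝ) : 0 < √(1 + U ^ 2) := Real.sqrt_pos.2 (by positivity)

theorem shape_zero : shape 0 = 1 := by simp [shape]

theorem shape_neg (U : ℝ) : shape (-U) = shape U := by simp [shape]

theorem shape_pos (U : ℝ) : 0 < shape U := by
  have := sqrt_one_add_sq_pos U
  unfold shape; positivity

theorem shape_le_one (U : ℝ) : shape U ≤ 1 := by
  have h1 : 1 ≤ √(1 + U ^ 2) := Real.one_le_sqrt.2 (by nlinarith [sq_nonneg U])
  unfold shape
  exact (div_le_one (by positivity)).2 (one_le_pow₀ h1)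

theorem contDiff_shape : ContDiff ℝ 1 shape := by
  unfold shape
  refine contDiff_const.div ((ContDiff.sqrt (by fun_prop) fun U => ?_).pow 3) fun U => ?_
  · positivity
  · exact (pow_pos (sqrt_one_add_sq_pos U) 3).ne'

/-- The reduced equations of motion at the angle `θ`: `q` is the inverse of the distance to the
axis, `u` the slope, in units of `ε`, at which the pair sees the vertical body, and `p`, `w` are
their derivatives with respect to the angle. -/
structure IsReducedAt (β ε : ℝ) (q p u w : ℝ → ℝ) (θ : ℝ) : Prop where
  pos : 0 < q θ
  deriv_q : HasDerivAt q (p θ) θ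
  deriv_p : HasDerivAt p (-q θ + β + (1 - β) * shape (ε * u θ)) θ
  deriv_u : HasDerivAt u (w θ) θ
  deriv_w : HasDerivAt w (-u θ - u θ * (β * (8 * shape (ε * u θ) - 1) / q θ)) θ

/-- States `(q, p, u, w, ε)`. -/
abbrev State : Type := ℝ × ℝ × ℝ × ℝ × ℝ

/-- The amplitude `ε` is a fifth coordinate at rest, so dependence on it is part of the dependence
on initial data. -/
noncomputable def reducedField (β : ℝ) (z : State) : State :=
  (z.2.1, -z.1 + β + (1 - β) * shape (z.2.2.2.2 * z.2.2.1), z.2.2.2.1,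
    -z.2.2.1 - z.2.2.1 * (β * (8 * shape (z.2.2.2.2 * z.2.2.1) - 1) / z.1), 0)

noncomputable def clamp (N x : ℝ) : ℝ := max (-N) (min N x)

theorem clamp_neg (N x : ℝ) (hN : 0 ≤ N) : clamp N (-x) = -clamp N x := by
  unfold clamp; grind

theorem clamp_eq {N x : ℝ} (h : |x| ≤ N) : clamp N x = x := by
  have := abs_le.1 h
  unfold clamp; grind

theorem clamp_mem {N : ℝ} (hN : 0 ≤ N) (x : ℝ) : clamp N x ∈ Icc (-N) N := by
  unfold clamp; constructor <;> grind

theorem abs_clamp_le {N : ℝ} (hN : 0 ≤ N) (x : ℝ) : |clamp N x| ≤ |x| := by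
  unfold clamp; grind

theorem lipschitzWith_clamp (N : ℝ) : LipschitzWith 1 (clamp N) :=
  (LipschitzWith.id.const_min N).const_max (-N)

noncomputable def clampBox (c N : ℝ) (z : State) : State :=
  (max c (min N z.1), clamp N z.2.1, clamp N z.2.2.1, clamp N z.2.2.2.1, clamp N z.2.2.2.2)

def stateBox (c N : ℝ) : Set State :=
  Icc c N ×ˢ Icc (-N) N ×ˢ Icc (-N) N ×ˢ Icc (-N) N ×ˢ Icc (-N) N

theorem clampBox_mem {c N : ℝ} (hN : 0 ≤ N) (hc : c ≤ N) (z : State) :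
    clampBox c N z ∈ stateBox c N :=
  ⟨⟨le_max_left _ _, max_le hc (min_le_left _ _)⟩, clamp_mem hN _, clamp_mem hN _,
    clamp_mem hN _, clamp_mem hN _⟩

theorem exists_lipschitzWith_clampBox (c N : ℝ) : ∃ K, LipschitzWith K (clampBox c N) :=
  ⟨_, (((LipschitzWith.id.const_min N).const_max c).comp LipschitzWith.prod_fst).prodMk
    (((lipschitzWith_clamp N).comp (LipschitzWith.prod_fst.comp LipschitzWith.prod_snd)).prodMk
    (((lipschitzWith_clamp N).comp (LipschitzWith.prod_fst.comp
      (LipschitzWith.prod_snd.comp LipschitzWith.prod_snd))).prodMk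
    (((lipschitzWith_clamp N).comp (LipschitzWith.prod_fst.comp
      (LipschitzWith.prod_snd.comp (LipschitzWith.prod_snd.comp LipschitzWith.prod_snd)))).prodMk
    ((lipschitzWith_clamp N).comp (LipschitzWith.prod_snd.comp
      (LipschitzWith.prod_snd.comp (LipschitzWith.prod_snd.comp LipschitzWith.prod_snd)))))))⟩

theorem contDiffOn_reducedField (β : ℝ) {c : ℝ} (hc : 0 < c) (N : ℝ) :
    ContDiffOn ℝ 1 (reducedField β) (stateBox c N) := by
  have hS : ContDiffOn ℝ 1 (fun z : State => shape (z.2.2.2.2 * z.2.2.1)) (stateBox c N) :=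
    (contDiff_shape.comp (by fun_prop : ContDiff ℝ 1 fun z : State =>
      z.2.2.2.2 * z.2.2.1)).contDiffOn
  have hq : ∀ z ∈ stateBox c N, z.1 ≠ 0 := fun z hz => (hc.trans_le hz.1.1).ne'
  unfold reducedField
  fun_prop (disch := assumption)

/-- Precomposing with the retraction onto a compact convex box, where the field is C¹, removes the
singularity `q = 0` and makes the flow global. Curves in the box solve the original equations. -/
theorem exists_lipschitz_bound (β : ℝ) {c N : ℝ} (hc : 0 < c) (hcN : c ≤ N) :
    ∃ K L : ℝ≥0, LipschitzWith K (fun z => reducedField β (clampBox c N z)) ∧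
      ∀ z, ‖reducedField β (clampBox c N z)‖ ≤ L := by
  have hN : 0 ≤ N := hc.le.trans hcN
  have hcomp : IsCompact (stateBox c N) := isCompact_Icc.prod (isCompact_Icc.prod
    (isCompact_Icc.prod (isCompact_Icc.prod isCompact_Icc)))
  have hconv : Convex ℝ (stateBox c N) := (convex_Icc _ _).prod ((convex_Icc _ _).prod
    ((convex_Icc _ _).prod ((convex_Icc _ _).prod (convex_Icc _ _))))
  have hcd := contDiffOn_reducedField β hc N
  obtain ⟨K, hK⟩ := hcd.exists_lipschitzOnWith one_ne_zero hconv hcomp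
  obtain ⟨K', hK'⟩ := exists_lipschitzWith_clampBox c N
  obtain ⟨L, hL⟩ := hcomp.exists_bound_of_continuousOn hcd.continuousOn
  refine ⟨K * K', L.toNNReal, ?_, fun z => (hL _ (clampBox_mem hN hcN z)).trans
    (Real.le_coe_toNNReal L)⟩
  rw [← lipschitzOnWith_univ]
  exact hK.comp hK'.lipschitzOnWith fun z _ => clampBox_mem hN hcN z

/-- Time reversal. -/
def reversal (z : State) : State := (z.1, -z.2.1, -z.2.2.1, z.2.2.2.1, z.2.2.2.2)

theorem reducedField_reversal (β : ℝ) {c N : ℝ} (hN : 0 ≤ N) (z : State) :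
    reducedField β (clampBox c N (reversal z)) =
      -reversal (reducedField β (clampBox c N z)) := by
  simp [reducedField, clampBox, reversal, clamp_neg _ _ hN, shape_neg]
  ring

theorem hasDerivAt_reversal {γ : ℝ → State} {v : State} {t : ℝ} (h : HasDerivAt γ v t) :
    HasDerivAt (fun s => reversal (γ s)) (reversal v) t := by
  have h1 := h.hasFDerivAt.fst.hasDerivAt
  have h2 := h.hasFDerivAt.snd.fst.hasDerivAt
  have h3 := h.hasFDerivAt.snd.snd.fst.hasDerivAt
  have h4 := h.hasFDerivAt.snd.snd.snd.fst.hasDerivAt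
  have h5 := h.hasFDerivAt.snd.snd.snd.snd.hasDerivAt
  simp at h1 h2 h3 h4 h5
  exact h1.prodMk (h2.neg.prodMk (h3.neg.prodMk (h4.prodMk h5)))

theorem hasDerivAt_comp_sub {E : Type*} [NormedAddCommGroup E] [NormedSpace ℝ E] {γ : ℝ → E}
    {v : E} {a t : ℝ} (h : HasDerivAt γ v (a - t)) : HasDerivAt (fun s => γ (a - s)) (-v) t := by
  have := h.scomp t ((hasDerivAt_id t).const_sub a)
  simpa [Function.comp_def] using this

theorem reversal_solution {β c N : ℝ} (hN : 0 ≤ N) {γ : ℝ → State}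
    (hγ : ∀ t, HasDerivAt γ (reducedField β (clampBox c N (γ t))) t) (a t : ℝ) :
    HasDerivAt (fun s => reversal (γ (a - s)))
      (reducedField β (clampBox c N (reversal (γ (a - t))))) t := by
  rw [reducedField_reversal β hN]
  have := hasDerivAt_reversal (hasDerivAt_comp_sub (hγ (a - t)))
  convert this using 1
  ext <;> simp [reversal]

/-- A solution that meets the fixed set of the reversal at `0` and `Θ` has period `2 Θ`. -/
theorem periodic_of_reversal {β c N : ℝ} (hN : 0 ≤ N) {K : ℝ≥0}
    (hK : LipschitzWith K (fun z => reducedField β (clampBox c N z))) {γ : ℝ → State}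
    (hγ : ∀ t, HasDerivAt γ (reducedField β (clampBox c N (γ t))) t) {Θ : ℝ}
    (h0 : reversal (γ 0) = γ 0) (hΘ : reversal (γ Θ) = γ Θ) :
    (∀ t, γ (-t) = reversal (γ t)) ∧ Function.Periodic γ (2 * Θ) := by
  have hs : ∀ a, reversal (γ a) = γ a → ∀ t, γ (a + t) = reversal (γ (a - t)) := by
    intro a ha t
    have h1 : ∀ t, HasDerivAt (fun s => γ (a + s)) (reducedField β (clampBox c N (γ (a + t)))) t :=
      fun t => by simpa using (hγ (a + t)).comp_const_add a t
    have := solution_unique hK h1 (reversal_solution hN hγ a) (by simp [ha])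
    exact congrFun this t
  have hr : ∀ z, reversal (reversal z) = z := fun z => by simp [reversal]
  have e0 : ∀ t, γ (-t) = reversal (γ t) := fun t => by
    have := hs 0 h0 (-t)
    simpa using this
  refine ⟨e0, fun t => ?_⟩
  have := hs Θ hΘ (Θ + t)
  rw [show t + 2 * Θ = Θ + (Θ + t) by ring, this, show Θ - (Θ + t) = -t by ring, e0, hr]

theorem State.hasDerivAt_components {γ : ℝ → State} {v : State} {t : ℝ} (h : HasDerivAt γ v t) :
    HasDerivAt (fun s => (γ s).1) v.1 t ∧ HasDerivAt (fun s => (γ s).2.1) v.2.1 t ∧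
      HasDerivAt (fun s => (γ s).2.2.1) v.2.2.1 t ∧
      HasDerivAt (fun s => (γ s).2.2.2.1) v.2.2.2.1 t ∧
      HasDerivAt (fun s => (γ s).2.2.2.2) v.2.2.2.2 t := by
  have h1 := h.hasFDerivAt.fst.hasDerivAt
  have h2 := h.hasFDerivAt.snd.fst.hasDerivAt
  have h3 := h.hasFDerivAt.snd.snd.fst.hasDerivAt
  have h4 := h.hasFDerivAt.snd.snd.snd.fst.hasDerivAt
  have h5 := h.hasFDerivAt.snd.snd.snd.snd.hasDerivAt
  simp at h1 h2 h3 h4 h5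
  exact ⟨h1, h2, h3, h4, h5⟩

/-- Grönwall in the sup norm of `(u, w)`; `C ≥ 1` covers both components. The bound does not involve
the size of the clamping box, so the box can be chosen afterwards. -/
theorem abs_le_exp_of_linear {u w w' u' : ℝ → ℝ} {C : ℝ} (hC : 1 ≤ C)
    (hu : ∀ t, HasDerivAt u (u' t) t) (hw : ∀ t, HasDerivAt w (w' t) t)
    (hu' : ∀ t, |u' t| ≤ |w t|) (hw' : ∀ t, |w' t| ≤ C * |u t|) (hu0 : u 0 = 0) (hw0 : w 0 = 1)
    {t : ℝ} (ht : 0 ≤ t) : |u t| ≤ Real.exp (C * t) ∧ |w t| ≤ Real.exp (C * t) := by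
  have := norm_le_gronwallBound_of_norm_deriv_right_le (f := fun s => (u s, w s))
    (f' := fun s => (u' s, w' s)) (δ := 1) (K := C) (ε := 0) (a := 0) (b := t)
    (fun s _ => ((hu s).prodMk (hw s)).continuousAt.continuousWithinAt)
    (fun s _ => ((hu s).prodMk (hw s)).hasDerivWithinAt) (by simp [hu0, hw0, Prod.norm_def])
    (fun s _ => by
      simp only [Prod.norm_def, Real.norm_eq_abs, add_zero]
      refine max_le ((hu' s).trans ?_) ((hw' s).trans ?_)
      · exact (le_max_right _ _).trans (le_mul_of_one_le_left (by positivity) hC)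
      · exact mul_le_mul_of_nonneg_left (le_max_left _ _) (by linarith)) t ⟨ht, le_rfl⟩
  rw [gronwallBound_ε0, one_mul, sub_zero] at this
  simp only [Prod.norm_def, Real.norm_eq_abs] at this
  exact ⟨(le_max_left _ _).trans this, (le_max_right _ _).trans this⟩

/-- The reduced field in the direction `w`, with clamped arguments, is bounded linearly in `u`. -/
theorem abs_reducedField_w_le {β c N : ℝ} (hβ : 0 < β) (hβ1 : β < 1) (hc : 0 < c) (hN : 0 ≤ N)
    (z : State) :
    |(reducedField β (clampBox c N z)).2.2.2.1| ≤ (1 + 7 / c) * |z.2.2.1| := by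
  set q := max c (min N z.1)
  set U := clamp N z.2.2.2.2 * clamp N z.2.2.1
  have hq : c ≤ q := le_max_left _ _
  have hq0 : 0 < q := hc.trans_le hq
  have h1 : |β * (8 * shape U - 1) / q| ≤ 7 / c := by
    rw [abs_div, abs_mul, abs_of_pos hβ, abs_of_pos hq0]
    have : |8 * shape U - 1| ≤ 7 :=
      abs_le.2 ⟨by linarith [shape_pos U], by linarith [shape_le_one U]⟩
    gcongr
    nlinarith [abs_nonneg (8 * shape U - 1)]
  have h2 : (reducedField β (clampBox c N z)).2.2.2.1 =
      -(clamp N z.2.2.1 * (1 + β * (8 * shape U - 1) / q)) := by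
    simp only [reducedField, clampBox, q, U]; ring
  rw [h2, abs_neg, abs_mul, mul_comm]
  have h3 : |1 + β * (8 * shape U - 1) / q| ≤ 1 + 7 / c :=
    (abs_add_le _ _).trans (by rw [abs_one]; linarith)
  have := abs_clamp_le hN z.2.2.1
  gcongr

theorem clampBox_eq {c N : ℝ} {z : State} (h1 : c ≤ z.1) (h1' : z.1 ≤ N) (h2 : |z.2.1| ≤ N)
    (h3 : |z.2.2.1| ≤ N) (h4 : |z.2.2.2.1| ≤ N) (h5 : |z.2.2.2.2| ≤ N) : clampBox c N z = z := by
  simp only [clampBox, min_eq_right h1', max_eq_right h1, clamp_eq h2, clamp_eq h3, clamp_eq h4,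
    clamp_eq h5]

/-- With `ε = 0` the clamped equations for `q`, `p` have the Kepler solutions. -/
theorem kepler_of_clamped {β c N e : ℝ} (he0 : 0 ≤ e) (hc : c ≤ 1 - e) (hN : 2 ≤ N)
    (he1 : e ≤ 1) {γ : ℝ → State} (hγ : ∀ t, HasDerivAt γ (reducedField β (clampBox c N (γ t))) t)
    (h0 : γ 0 = (1 + e, 0, 0, 1, 0)) {t : ℝ} (ht : 0 ≤ t) :
    (γ t).1 = 1 + e * Real.cos t ∧ (γ t).2.1 = -(e * Real.sin t) := by
  have hd := fun t => State.hasDerivAt_components (hγ t)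
  have h5 : ∀ t, (γ t).2.2.2.2 = 0 := by
    intro t
    have := is_const_of_deriv_eq_zero (f := fun s => (γ s).2.2.2.2)
      (fun s => (hd s).2.2.2.2.differentiableAt) (fun s => (hd s).2.2.2.2.deriv) t 0
    simpa [h0] using this
  have hcos : ∀ s, c ≤ 1 + e * Real.cos s ∧ 1 + e * Real.cos s ≤ N := fun s =>
    ⟨by nlinarith [Real.neg_one_le_cos s], by nlinarith [Real.cos_le_one s]⟩
  have hsin : ∀ s, |-(e * Real.sin s)| ≤ N := fun s => by
    rw [abs_neg, abs_mul, abs_of_nonneg he0]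
    nlinarith [Real.abs_sin_le_one s, abs_nonneg (Real.sin s)]
  have hcl : ∀ x y : ℝ, |max c (min N x) - max c (min N y)| ≤ |x - y| := fun x y => by
    simpa [Real.dist_eq] using
      ((LipschitzWith.id.const_min N).const_max c).dist_le_mul x y
  have hcl' : ∀ x y : ℝ, |clamp N x - clamp N y| ≤ |x - y| := fun x y => by
    simpa [Real.dist_eq] using (lipschitzWith_clamp N).dist_le_mul x y
  have hq : ∀ s, HasDerivAt (fun s => (γ s).1 - (1 + e * Real.cos s))
      (clamp N (γ s).2.1 - clamp N (-(e * Real.sin s))) s := fun s => by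
    have := (hd s).1.sub (((Real.hasDerivAt_cos s).const_mul e).const_add 1)
    refine this.congr_deriv ?_
    rw [clamp_eq (hsin s)]
    simp [reducedField, clampBox]
  have hp : ∀ s, HasDerivAt (fun s => (γ s).2.1 - -(e * Real.sin s))
      (-(max c (min N (γ s).1) - max c (min N (1 + e * Real.cos s)))) s := fun s => by
    have := (hd s).2.1.sub ((Real.hasDerivAt_sin s).const_mul e).neg
    refine this.congr_deriv ?_
    have h00 : clamp N 0 = 0 := clamp_eq (by simp; linarith)
    rw [min_eq_right (hcos s).2, max_eq_right (hcos s).1]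
    simp [reducedField, clampBox, h5 s, h00, shape_zero]
    ring
  -- Clamping is 1-Lipschitz and fixes the Kepler orbit, so Grönwall applies to the difference
  -- without knowing beforehand that `γ` stays in the box.
  have := eq_zero_of_abs_deriv_le_mul_abs_self_of_eq_zero_right
    (f := fun s => ((γ s).1 - (1 + e * Real.cos s), (γ s).2.1 - -(e * Real.sin s)))
    (K := 1) (a := 0) (b := t)
    (fun s _ => ((hq s).prodMk (hp s)).continuousAt.continuousWithinAt)
    (fun s _ => ((hq s).prodMk (hp s)).hasDerivWithinAt) (by simp [h0])
    (fun s _ => by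
      simp only [Prod.norm_def, Real.norm_eq_abs, one_mul, abs_neg]
      exact max_le ((hcl' _ _).trans (le_max_right _ _)) ((hcl _ _).trans (le_max_left _ _)))
    t ⟨ht, le_rfl⟩
  have h := Prod.mk_inj.1 this
  exact ⟨by linarith [h.1], by linarith [h.2]⟩

/-! ### The two-parameter family of reduced orbits. -/

/-- A continuous family, indexed by the eccentricity `e` and the amplitude `ε`, of solutions of the
reduced equations on `[0, T]`, which are global and periodic if they close up before `T`. -/
structure IsReducedFamily (β m T d c N : ℝ) (q p u w : ℝ → ℝ → ℝ → ℝ) : Prop where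
  cont_q : Continuous fun z : ℝ × ℝ × ℝ => q z.1 z.2.1 z.2.2
  cont_p : Continuous fun z : ℝ × ℝ × ℝ => p z.1 z.2.1 z.2.2
  cont_u : Continuous fun z : ℝ × ℝ × ℝ => u z.1 z.2.1 z.2.2
  cont_w : Continuous fun z : ℝ × ℝ × ℝ => w z.1 z.2.1 z.2.2
  q_zero : ∀ e ε, q e ε 0 = 1 + e
  p_zero : ∀ e ε, p e ε 0 = 0
  u_zero : ∀ e ε, u e ε 0 = 0
  w_zero : ∀ e ε, w e ε 0 = 1
  reduced : ∀ e ∈ Icc 0 m, ∀ ε ∈ Icc 0 d, ∀ θ ∈ Icc 0 T,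
    IsReducedAt β ε (q e ε) (p e ε) (u e ε) (w e ε) θ
  kepler_q : ∀ e ∈ Icc 0 m, ∀ θ ∈ Icc 0 T, q e 0 θ = 1 + e * Real.cos θ
  kepler_p : ∀ e ∈ Icc 0 m, ∀ θ ∈ Icc 0 T, p e 0 θ = -(e * Real.sin θ)
  closed : ∀ e ∈ Icc 0 m, ∀ ε ∈ Icc 0 d, ∀ Θ ∈ Ioc 0 T, p e ε Θ = 0 → u e ε Θ = 0 →
    (∀ θ, IsReducedAt β ε (q e ε) (p e ε) (u e ε) (w e ε) θ) ∧
    (∀ θ, c ≤ q e ε θ ∧ q e ε θ ≤ N ∧ |p e ε θ| ≤ N) ∧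
    Function.Periodic (q e ε) (2 * Θ) ∧ Function.Periodic (u e ε) (2 * Θ)

theorem exists_reducedFamily {β m T : ℝ} (hβ : 0 < β) (hβ1 : β < 1) (hm : 0 < m) (hm1 : m < 1) :
    ∃ d > 0, ∃ c > 0, ∃ N, ∃ q p u w : ℝ → ℝ → ℝ → ℝ, IsReducedFamily β m T d c N q p u w := by
  -- Half the smallest value `1 - m` of `1 + e cos θ`: the Kepler orbits stay strictly inside the
  -- box, and `q`, `p` remain there on `[0, T]` for small `ε`.
  set c := (1 - m) / 2 with hc_def
  have hc : 0 < c := by simp only [hc_def]; linarith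
  set C := 1 + 7 / c
  have hC : 1 ≤ C := by have : 0 < 7 / c := by positivity
                        simp only [C]; linarith
  set N := 3 + Real.exp (C * T)
  have hN3 : 3 < N := by simp only [N]; linarith [Real.exp_pos (C * T)]
  have hN : 0 ≤ N := by linarith
  have hcN : c ≤ N := by simp only [hc_def]; linarith
  obtain ⟨K, L, hK, hL⟩ := exists_lipschitz_bound β hc hcN
  obtain ⟨φ, hφ0, hφ, hφc⟩ := exists_flow hK hL
  set z : ℝ → ℝ → ℝ → State := fun e ε => φ (1 + e, 0, 0, 1, ε) with hz_def
  have hz0 : ∀ e ε, z e ε 0 = (1 + e, 0, 0, 1, ε) := fun e ε => hφ0 _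
  have hz : ∀ e ε t, HasDerivAt (z e ε) (reducedField β (clampBox c N (z e ε t))) t :=
    fun e ε => hφ _
  have hzc : Continuous fun x : ℝ × ℝ × ℝ => z x.1 x.2.1 x.2.2 :=
    hφc.comp (by fun_prop : Continuous fun x : ℝ × ℝ × ℝ =>
      (((1 + x.1, 0, 0, 1, x.2.1), x.2.2) : State × ℝ))
  have hd := fun e ε t => State.hasDerivAt_components (hz e ε t)
  have hε : ∀ e ε t, (z e ε t).2.2.2.2 = ε := by
    intro e ε t
    have := is_const_of_deriv_eq_zero (f := fun s => (z e ε s).2.2.2.2)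
      (fun s => (hd e ε s).2.2.2.2.differentiableAt) (fun s => (hd e ε s).2.2.2.2.deriv) t 0
    simpa [hz0] using this
  have huw : ∀ e ε, ∀ t ∈ Icc 0 T, |(z e ε t).2.2.1| ≤ N ∧ |(z e ε t).2.2.2.1| ≤ N := by
    intro e ε t ht
    have h := abs_le_exp_of_linear hC (fun t => (hd e ε t).2.2.1) (fun t => (hd e ε t).2.2.2.1)
      (fun t => abs_clamp_le hN _) (fun t => abs_reducedField_w_le hβ hβ1 hc hN _)
      (by simp [hz0]) (by simp [hz0]) ht.1
    have hle : Real.exp (C * t) ≤ N := by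
      have : Real.exp (C * t) ≤ Real.exp (C * T) := Real.exp_le_exp.2
        (mul_le_mul_of_nonneg_left ht.2 (by linarith))
      simp only [N]; linarith
    exact ⟨h.1.trans hle, h.2.trans hle⟩
  have hkep : ∀ e ∈ Icc 0 m, ∀ t ∈ Icc 0 T, (z e 0 t).1 = 1 + e * Real.cos t ∧
      (z e 0 t).2.1 = -(e * Real.sin t) := fun e he t ht =>
    kepler_of_clamped he.1 (by simp only [hc_def]; linarith [he.2]) (by linarith)
      (by linarith [he.2]) (hz e 0) (hz0 e 0) ht.1
  obtain ⟨d, hd0, hdpos⟩ := exists_forall_pos_of_pos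
    (K := (Icc 0 m ×ˢ Icc 0 T : Set (ℝ × ℝ))) (isCompact_Icc.prod isCompact_Icc)
    (f := fun x ε => min ((z x.1 ε x.2).1 - c) (min (N - (z x.1 ε x.2).1)
      (min (N - (z x.1 ε x.2).2.1) (N + (z x.1 ε x.2).2.1))))
    (by
      have : Continuous fun x : (ℝ × ℝ) × ℝ => z x.1.1 x.2 x.1.2 :=
        hzc.comp (by fun_prop : Continuous fun x : (ℝ × ℝ) × ℝ => (x.1.1, x.2, x.1.2))
      fun_prop)
    (by
      rintro ⟨e, t⟩ ⟨he, ht⟩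
      obtain ⟨h1, h2⟩ := hkep e he t ht
      have hc1 := Real.cos_le_one t
      have hc2 := Real.neg_one_le_cos t
      have hs1 := Real.sin_le_one t
      have hs2 := Real.neg_one_le_sin t
      have he0 : 0 ≤ e := he.1
      have he1 : e ≤ m := he.2
      simp only [h1, h2, lt_min_iff]
      refine ⟨?_, ?_, ?_, ?_⟩
      · simp only [hc_def]; nlinarith
      all_goals nlinarith)
  have hbox : ∀ e ∈ Icc 0 m, ∀ ε ∈ Icc 0 (min d 1), ∀ t ∈ Icc 0 T,
      c ≤ (z e ε t).1 ∧ (z e ε t).1 ≤ N ∧ |(z e ε t).2.1| ≤ N ∧ |(z e ε t).2.2.1| ≤ N ∧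
        |(z e ε t).2.2.2.1| ≤ N ∧ |(z e ε t).2.2.2.2| ≤ N := by
    intro e he ε hε' t ht
    have := hdpos ε ⟨hε'.1, hε'.2.trans (min_le_left _ _)⟩ (e, t) ⟨he, ht⟩
    simp only [lt_min_iff] at this
    obtain ⟨h1, h2, h3, h4⟩ := this
    have h5 : ε ≤ 1 := hε'.2.trans (min_le_right _ _)
    refine ⟨by linarith, by linarith, abs_le.2 ⟨by linarith, by linarith⟩, (huw e ε t ht).1,
      (huw e ε t ht).2, ?_⟩
    rw [hε, abs_of_nonneg hε'.1]
    linarith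
  have hred : ∀ e ε t, (c ≤ (z e ε t).1 ∧ (z e ε t).1 ≤ N ∧ |(z e ε t).2.1| ≤ N ∧
      |(z e ε t).2.2.1| ≤ N ∧ |(z e ε t).2.2.2.1| ≤ N ∧ |(z e ε t).2.2.2.2| ≤ N) →
      IsReducedAt β ε (fun t => (z e ε t).1) (fun t => (z e ε t).2.1)
        (fun t => (z e ε t).2.2.1) (fun t => (z e ε t).2.2.2.1) t := by
    rintro e ε t ⟨h1, h2, h3, h4, h5, h6⟩
    have hdt := hd e ε t
    rw [clampBox_eq h1 h2 h3 h4 h5 h6] at hdt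
    simp only [reducedField, hε] at hdt
    exact ⟨hc.trans_le h1, hdt.1, hdt.2.1, hdt.2.2.1, hdt.2.2.2.1⟩
  refine ⟨min d 1, lt_min hd0 one_pos, c, hc, N, fun e ε t => (z e ε t).1,
    fun e ε t => (z e ε t).2.1, fun e ε t => (z e ε t).2.2.1, fun e ε t => (z e ε t).2.2.2.1, ?_⟩
  refine ⟨by fun_prop, by fun_prop, by fun_prop, by fun_prop, by simp [hz0], by simp [hz0],
    by simp [hz0], by simp [hz0], fun e he ε hε' θ hθ => hred e ε θ (hbox e he ε hε' θ hθ),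
    fun e he θ hθ => (hkep e he θ hθ).1, fun e he θ hθ => (hkep e he θ hθ).2, ?_⟩
  intro e he ε hε' Θ hΘ hpΘ huΘ
  obtain ⟨heven, hper⟩ := periodic_of_reversal hN hK (hz e ε) (Θ := Θ)
    (by simp [reversal, hz0]) (by ext <;> simp [reversal, hpΘ, huΘ])
  have hall : ∀ t, c ≤ (z e ε t).1 ∧ (z e ε t).1 ≤ N ∧ |(z e ε t).2.1| ≤ N ∧
      |(z e ε t).2.2.1| ≤ N ∧ |(z e ε t).2.2.2.1| ≤ N ∧ |(z e ε t).2.2.2.2| ≤ N := by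
    intro t
    -- Periodicity moves any time into `[-Θ, Θ)` and reversal into `[0, Θ]`, where the box bounds
    -- are known.
    obtain ⟨s, hs, hst⟩ := hper.exists_mem_Ico (by linarith [hΘ.1]) t (-Θ)
    rw [hst]
    have hs2 : s < Θ := by linarith [hs.2]
    rcases le_total 0 s with h | h
    · exact hbox e he ε hε' s ⟨h, by linarith [hΘ.2]⟩
    · have := hbox e he ε hε' (-s) ⟨by linarith, by linarith [hs.1, hΘ.2]⟩
      rw [heven] at this
      simpa [reversal] using this
  exact ⟨fun θ => hred e ε θ (hall θ), fun θ => ⟨(hall θ).1, (hall θ).2.1, (hall θ).2.2.1⟩,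
    fun t => by simp only [hper t], fun t => by simp only [hper t]⟩

/-! ### Oscillation of the variational equation along Kepler orbits. -/

/-- Amplitude of the weight in the comparison argument. -/
noncomputable def weightAmp (β e : ℝ) : ℝ := 14 * β * e / (3 + 28 * β)

/-- Frequency in the comparison argument. -/
noncomputable def weightFreq (β e : ℝ) : ℝ :=
  √((1 + 7 * β) * (1 - weightAmp β e ^ 2) + 3 / 32 * (3 + 28 * β) * weightAmp β e ^ 2)

theorem weightAmp_nonneg {β e : ℝ} (hβ : 0 < β) (he : 0 ≤ e) : 0 ≤ weightAmp β e := by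
  unfold weightAmp; positivity

theorem weightAmp_lt_half {β e : ℝ} (hβ : 0 < β) (he1 : e < 1) :
    weightAmp β e < 1 / 2 := by
  unfold weightAmp
  rw [div_lt_iff₀ (by positivity)]
  nlinarith

theorem weightFreq_sq {β e : ℝ} (hβ : 0 < β) (he : 0 ≤ e) (he1 : e < 1) :
    weightFreq β e ^ 2 =
      (1 + 7 * β) * (1 - weightAmp β e ^ 2) + 3 / 32 * (3 + 28 * β) * weightAmp β e ^ 2 := by
  have h0 := weightAmp_nonneg hβ he
  have h1 := weightAmp_lt_half hβ he1
  refine Real.sq_sqrt (add_nonneg (mul_nonneg (by positivity) ?_) (by positivity))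
  nlinarith

theorem weightFreq_pos {β e : ℝ} (hβ : 0 < β) (he : 0 ≤ e) (he1 : e < 1) :
    0 < weightFreq β e := by
  have h0 := weightAmp_nonneg hβ he
  have h1 := weightAmp_lt_half hβ he1
  refine Real.sqrt_pos.2 (add_pos_of_pos_of_nonneg (mul_pos (by positivity) ?_) (by positivity))
  nlinarith

theorem weightAmp_zero (β : ℝ) : weightAmp β 0 = 0 := by simp [weightAmp]

theorem weightFreq_zero (β : ℝ) : weightFreq β 0 = √(1 + 7 * β) := by
  simp [weightFreq, weightAmp_zero]

/-- The frequency averaged over the weight exceeds the frequency of the circular orbit. -/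
theorem sqrt_lt_weightFreq_mul {β e : ℝ} (hβ : 0 < β) (he : 0 < e) (he1 : e < 1) :
    √(1 + 7 * β) < weightFreq β e * (1 + weightAmp β e ^ 2 / 2) := by
  have h1 := weightAmp_lt_half hβ he1
  have h0 : 0 < weightAmp β e := by unfold weightAmp; positivity
  have hν := weightFreq_pos hβ he.le he1
  have hsq := weightFreq_sq hβ he.le he1
  set b := weightAmp β e
  set ν := weightFreq β e
  refine Real.sqrt_lt' (by positivity) |>.2 ?_
  have hb2 : b ^ 2 < 1 / 4 := by nlinarith
  have hb0 : 0 < b ^ 2 := by positivity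
  rw [mul_pow, hsq]
  set B := b ^ 2
  -- The factor `1 - B` in the squared frequency costs only `B²` against `1 + B`; the term `3/32 *
  -- (3 + 28 * β) * B` outweighs this since `B < 1/4`.
  have e1 : 1 + B ≤ (1 + B / 2) ^ 2 := by nlinarith
  have hpos : 0 < (1 + 7 * β) * (1 - B) + 3 / 32 * (3 + 28 * β) * B := by
    have : 0 < 1 - B := by linarith
    positivity
  refine lt_of_lt_of_le ?_ (mul_le_mul_of_nonneg_left e1 hpos.le)
  have : ((1 + 7 * β) * (1 - B) + 3 / 32 * (3 + 28 * β) * B) * (1 + B) - (1 + 7 * β) =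
      B * (3 / 32 * (3 + 28 * β) * (1 + B) - (1 + 7 * β) * B) := by ring
  have h2 : 0 < 3 / 32 * (3 + 28 * β) * (1 + B) - (1 + 7 * β) * B := by nlinarith
  nlinarith [mul_pos hb0 h2]

/-- The key inequality: the variational equation along an eccentric orbit oscillates faster than
its comparison equation. -/
theorem weight_comparison {β e x : ℝ} (hβ : 0 < β) (he : 0 ≤ e) (he1 : e < 1) (hx : |x| ≤ 1) :
    weightFreq β e ^ 2 ≤ (1 + 7 * β / (1 + e * x)) * (1 + weightAmp β e * x) ^ 2 -
      (1 + weightAmp β e * x) * (weightAmp β e * x) / 2 -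
      weightAmp β e ^ 2 * (1 - x ^ 2) / 4 := by
  rw [weightFreq_sq hβ he he1]
  have h1 := weightAmp_lt_half hβ he1
  have h0 := weightAmp_nonneg hβ he
  -- The amplitude is chosen so that the part of the difference linear in `x`, which has no sign,
  -- cancels; the remaining terms are nonnegative.
  have hbe : 2 * weightAmp β e * (3 + 28 * β) = 28 * β * e := by
    unfold weightAmp; field_simp; ring
  set b := weightAmp β e
  obtain ⟨hx1, hx2⟩ := abs_le.1 hx
  have hex : 0 < 1 + e * x := by nlinarith
  have key : ((1 + 7 * β / (1 + e * x)) * (1 + b * x) ^ 2 - (1 + b * x) * (b * x) / 2 -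
      b ^ 2 * (1 - x ^ 2) / 4 - ((1 + 7 * β) * (1 - b ^ 2) + 3 / 32 * (3 + 28 * β) * b ^ 2)) *
      (4 * (1 + e * x)) = x * (2 * b * (3 + 28 * β) - 28 * β * e) +
      3 * e * b * x ^ 2 * (2 + b * x) +
      (3 + 28 * β) * b ^ 2 * (x ^ 2 + 5 / 8 * (1 + e * x)) := by
    field_simp; ring
  have hbx : 0 ≤ 2 + b * x := by nlinarith
  have : 0 ≤ ((1 + 7 * β / (1 + e * x)) * (1 + b * x) ^ 2 - (1 + b * x) * (b * x) / 2 -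
      b ^ 2 * (1 - x ^ 2) / 4 - ((1 + 7 * β) * (1 - b ^ 2) + 3 / 32 * (3 + 28 * β) * b ^ 2)) *
      (4 * (1 + e * x)) := by
    rw [key, hbe, sub_self, mul_zero, zero_add]
    positivity
  have := nonneg_of_mul_nonneg_left this (by positivity)
  linarith

/-- The Prüfer vector of a solution `(u, w)` of the variational equation. -/
noncomputable def prufer (β e θ u w : ℝ) : ℂ :=
  ⟨(1 + weightAmp β e * Real.cos θ) * w + weightAmp β e * Real.sin θ / 2 * u,
    weightFreq β e * u⟩

theorem hasDerivAt_complex_mk {f g : ℝ → ℝ} {f' g' t : ℝ} (hf : HasDerivAt f f' t)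
    (hg : HasDerivAt g g' t) : HasDerivAt (fun s => (⟨f s, g s⟩ : ℂ)) ⟨f', g'⟩ t := by
  simp only [Complex.mk_eq_add_mul_I]
  exact hf.ofReal_comp.add (hg.ofReal_comp.mul_const Complex.I)

/-- This is a Liouville transformation. With s = 1 + b cos θ, v = u/√s and dτ = dθ/s, the Prüfer
vector is √s (dv/dτ + iνv). If u'' = -Qu, then v satisfies d²v/dτ² + (Qs² + ss''/2 - s'²/4)v = 0,
whose coefficient `weight_comparison` bounds below by ν². -/
theorem hasDerivAt_prufer {β e θ : ℝ} {u w : ℝ → ℝ} {w' : ℝ} (hu : HasDerivAt u (w θ) θ)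
    (hw : HasDerivAt w w' θ) :
    HasDerivAt (fun s => prufer β e s (u s) (w s))
      ⟨(1 + weightAmp β e * Real.cos θ) * w' - weightAmp β e * Real.sin θ / 2 * w θ +
        weightAmp β e * Real.cos θ / 2 * u θ, weightFreq β e * w θ⟩ θ := by
  have h1 : HasDerivAt (fun s => (1 + weightAmp β e * Real.cos s) * w s +
      weightAmp β e * Real.sin s / 2 * u s) ((1 + weightAmp β e * Real.cos θ) * w' -
      weightAmp β e * Real.sin θ / 2 * w θ + weightAmp β e * Real.cos θ / 2 * u θ) θ := by
    have := ((((Real.hasDerivAt_cos θ).const_mul (weightAmp β e)).const_add 1).mul hw).add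
      ((((Real.hasDerivAt_sin θ).const_mul (weightAmp β e)).div_const 2).mul hu)
    refine this.congr_deriv ?_
    ring
  have h2 := hu.const_mul (weightFreq β e)
  exact hasDerivAt_complex_mk h1 h2

theorem prufer_ne_zero {β e θ u w : ℝ} (hβ : 0 < β) (he : 0 ≤ e) (he1 : e < 1)
    (h : (u, w) ≠ 0) : prufer β e θ u w ≠ 0 := by
  intro h0
  have hi := congrArg Complex.im h0
  have hr := congrArg Complex.re h0
  simp only [prufer, Complex.zero_im, Complex.zero_re] at hi hr
  have hu : u = 0 := by
    rcases mul_eq_zero.1 hi with h | h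
    · exact absurd h (weightFreq_pos hβ he he1).ne'
    · exact h
  have h1 := weightAmp_lt_half hβ he1
  have h2 := weightAmp_nonneg hβ he
  rw [hu, mul_zero, add_zero] at hr
  have hs : 1 + weightAmp β e * Real.cos θ ≠ 0 := by nlinarith [Real.neg_one_le_cos θ]
  have hw : w = 0 := by
    rcases mul_eq_zero.1 hr with h | h
    · exact absurd h hs
    · exact h
  exact h (by simp [hu, hw])

/-- The angular velocity of the Prüfer vector: bounded below, and constant for `e = 0`. -/
theorem le_im_prufer_div {β e θ u w : ℝ} (hβ : 0 < β) (he : 0 ≤ e) (he1 : e < 1)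
    (h : (u, w) ≠ 0) :
    weightFreq β e / (1 + weightAmp β e * Real.cos θ) ≤
      ((⟨(1 + weightAmp β e * Real.cos θ) * (-(1 + 7 * β / (1 + e * Real.cos θ)) * u) -
        weightAmp β e * Real.sin θ / 2 * w + weightAmp β e * Real.cos θ / 2 * u,
        weightFreq β e * w⟩ : ℂ) / prufer β e θ u w).im := by
  have hne := prufer_ne_zero (θ := θ) hβ he he1 h
  have hn : 0 < Complex.normSq (prufer β e θ u w) := Complex.normSq_pos.2 hne
  have hcmp := weight_comparison hβ he he1 (Real.abs_cos_le_one θ)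
  have hν := weightFreq_pos hβ he he1
  have h1 := weightAmp_lt_half hβ he1
  have h2 := weightAmp_nonneg hβ he
  have hs : 0 < 1 + weightAmp β e * Real.cos θ := by nlinarith [Real.neg_one_le_cos θ]
  rw [Complex.div_im, ← sub_div, div_le_div_iff₀ hs hn, Complex.normSq_apply]
  simp only [prufer]
  have hsc : Real.sin θ ^ 2 = 1 - Real.cos θ ^ 2 := Real.sin_sq θ
  set Q := 1 + 7 * β / (1 + e * Real.cos θ)
  set b := weightAmp β e
  set ν := weightFreq β e
  set x := Real.cos θ
  set y := Real.sin θ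
  -- Angular velocity minus ν/s, cleared of denominators: the `w` terms drop out, leaving u² times
  -- the excess of the transformed coefficient over ν².
  have key : (ν * w * ((1 + b * x) * w + b * y / 2 * u) -
      ((1 + b * x) * (-Q * u) - b * y / 2 * w + b * x / 2 * u) * (ν * u)) * (1 + b * x) -
      ν * (((1 + b * x) * w + b * y / 2 * u) * ((1 + b * x) * w + b * y / 2 * u) +
      ν * u * (ν * u)) =
      ν * u ^ 2 * (Q * (1 + b * x) ^ 2 - (1 + b * x) * (b * x) / 2 - b ^ 2 * y ^ 2 / 4 - ν ^ 2) := by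
    ring
  rw [hsc] at key
  have : 0 ≤ ν * u ^ 2 * (Q * (1 + b * x) ^ 2 - (1 + b * x) * (b * x) / 2 -
      b ^ 2 * (1 - x ^ 2) / 4 - ν ^ 2) := mul_nonneg (by positivity) (by linarith)
  linarith

theorem im_prufer_div_zero {β θ u w : ℝ} (hβ : 0 < β) (h : (u, w) ≠ 0) :
    ((⟨(1 + weightAmp β 0 * Real.cos θ) * (-(1 + 7 * β / (1 + 0 * Real.cos θ)) * u) -
        weightAmp β 0 * Real.sin θ / 2 * w + weightAmp β 0 * Real.cos θ / 2 * u,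
        weightFreq β 0 * w⟩ : ℂ) / prufer β 0 θ u w).im = weightFreq β 0 := by
  have hne := prufer_ne_zero (θ := θ) hβ le_rfl zero_lt_one h
  have hn : 0 < Complex.normSq (prufer β 0 θ u w) := Complex.normSq_pos.2 hne
  have hsq := weightFreq_sq hβ le_rfl zero_lt_one
  rw [Complex.div_im, ← sub_div, div_eq_iff hn.ne', Complex.normSq_apply]
  simp only [prufer, weightAmp_zero] at hsq ⊢
  simp only [zero_mul, add_zero, zero_div, div_one, sub_zero, one_mul]
  linear_combination -(weightFreq β 0 * u ^ 2) * hsq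

/-- A solution of a linear equation that does not vanish at `0` does not vanish later. -/
theorem ne_zero_of_linear {u w Q : ℝ → ℝ} {T C : ℝ} (hC : ∀ t ∈ Icc 0 T, |Q t| ≤ C)
    (hu : ∀ t ∈ Icc 0 T, HasDerivAt u (w t) t) (hw : ∀ t ∈ Icc 0 T, HasDerivAt w (-Q t * u t) t)
    (h0 : w 0 ≠ 0) {t : ℝ} (ht : t ∈ Icc 0 T) : (u t, w t) ≠ 0 := by
  intro hzero
  have hmem : ∀ s ∈ Icc 0 t, t - s ∈ Icc 0 T := fun s hs => ⟨by linarith [hs.2],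
    by linarith [hs.1, ht.2]⟩
  -- Run backwards from a supposed zero at `t`, Grönwall would force `w 0 = 0`.
  have hd : ∀ s ∈ Icc 0 t, HasDerivAt (fun s => (u (t - s), w (t - s)))
      (-w (t - s), -(-Q (t - s) * u (t - s))) s := fun s hs =>
    (hasDerivAt_comp_sub (hu _ (hmem s hs))).prodMk (hasDerivAt_comp_sub (hw _ (hmem s hs)))
  have := eq_zero_of_abs_deriv_le_mul_abs_self_of_eq_zero_right
    (f := fun s => (u (t - s), w (t - s))) (K := max C 1) (a := 0) (b := t)
    (fun s hs => (hd s hs).continuousAt.continuousWithinAt)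
    (fun s hs => (hd s (Ico_subset_Icc_self hs)).hasDerivWithinAt) (by simpa using hzero)
    (fun s hs => by
      have hQ := hC _ (hmem s (Ico_subset_Icc_self hs))
      simp only [Prod.norm_def, Real.norm_eq_abs, abs_neg, abs_mul]
      refine max_le ?_ ?_
      · exact (le_max_right _ _).trans (le_mul_of_one_le_left (by positivity) (le_max_right _ _))
      · exact mul_le_mul (hQ.trans (le_max_left _ _)) (le_max_left _ _) (abs_nonneg _)
          (by positivity))
    t ⟨ht.1, le_rfl⟩
  simp only [sub_self] at this
  exact h0 (Prod.mk_eq_zero.1 this).2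

/-- A lower bound of `1 / (1 + b cos)` with an explicit primitive. -/
theorem one_div_ge (x : ℝ) (hx : 0 < 1 + x) : 1 - x + x ^ 2 - x ^ 3 ≤ 1 / (1 + x) := by
  rw [le_div_iff₀ hx]
  nlinarith [sq_nonneg (x ^ 2)]

/-- The primitive of the cubic truncation of 1/(1 + b cos θ). At multiples of π only its mean 1 +
b²/2 survives. -/
noncomputable def comparisonPhase (b θ : ℝ) : ℝ :=
  θ - b * Real.sin θ + b ^ 2 * (θ / 2 + Real.sin θ * Real.cos θ / 2) -
    b ^ 3 * (Real.sin θ - Real.sin θ ^ 3 / 3)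

theorem hasDerivAt_comparisonPhase (b θ : ℝ) : HasDerivAt (comparisonPhase b)
    (1 - b * Real.cos θ + (b * Real.cos θ) ^ 2 - (b * Real.cos θ) ^ 3) θ := by
  have hs := Real.hasDerivAt_sin θ
  have hc := Real.hasDerivAt_cos θ
  have h := (((hasDerivAt_id θ).sub (hs.const_mul b)).add
    ((((hasDerivAt_id θ).div_const 2).add ((hs.mul hc).div_const 2)).const_mul (b ^ 2))).sub
    ((hs.sub ((hs.pow 3).div_const 3)).const_mul (b ^ 3))
  refine h.congr_deriv ?_
  have := Real.sin_sq θ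
  push_cast
  linear_combination (-b ^ 2 / 2 + b ^ 3 * Real.cos θ) * this

theorem comparisonPhase_nat_mul_pi (b : ℝ) (k : ℕ) :
    comparisonPhase b (k * Real.pi) = (1 + b ^ 2 / 2) * (k * Real.pi) := by
  simp only [comparisonPhase, Real.sin_nat_mul_pi]
  ring

/-- If the solutions of the variational equation along the Kepler orbits of eccentricity `e ≤ m`
turn sufficiently faster for `e = m` than for `e = 0`, their value at the angle `k π` changes
sign. -/
theorem exists_sign_change {β m : ℝ} (hβ : 0 < β) (hm : 0 < m) (hm1 : m < 1) {k : ℕ}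
    (hk : √(1 + 7 * β) * (k * Real.pi) + 2 * Real.pi ≤
      weightFreq β m * (1 + weightAmp β m ^ 2 / 2) * (k * Real.pi))
    {u w : ℝ → ℝ → ℝ} (hu : Continuous fun z : ℝ × ℝ => u z.1 z.2)
    (hw : Continuous fun z : ℝ × ℝ => w z.1 z.2) (hu0 : ∀ e, u e 0 = 0) (hw0 : ∀ e, w e 0 = 1)
    (hdu : ∀ e ∈ Icc 0 m, ∀ θ ∈ Icc 0 (k * Real.pi), HasDerivAt (u e) (w e θ) θ)
    (hdw : ∀ e ∈ Icc 0 m, ∀ θ ∈ Icc 0 (k * Real.pi),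
      HasDerivAt (w e) (-(1 + 7 * β / (1 + e * Real.cos θ)) * u e θ) θ) :
    ∃ e₁ ∈ Ioc 0 m, ∃ e₂ ∈ Ioc 0 m, u e₁ (k * Real.pi) < 0 ∧ 0 < u e₂ (k * Real.pi) := by
  have hpi := Real.pi_pos
  set T : ℝ := k * Real.pi with hT
  have hT0 : 0 ≤ T := by positivity
  have hne : ∀ e ∈ Icc 0 m, ∀ θ ∈ Icc 0 T, (u e θ, w e θ) ≠ 0 := by
    intro e he θ hθ
    refine ne_zero_of_linear (Q := fun θ => 1 + 7 * β / (1 + e * Real.cos θ))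
      (C := 1 + 7 * β / (1 - m)) ?_ (hdu e he) (hdw e he) (by simp [hw0]) hθ
    intro t _
    have h1 : 1 - m ≤ 1 + e * Real.cos t := by nlinarith [Real.neg_one_le_cos t, he.1, he.2]
    have h2 : 0 < 1 - m := by linarith
    have h3 : 0 < 1 + e * Real.cos t := by linarith
    rw [abs_of_pos (by positivity)]
    gcongr
  set P : ℝ → ℝ := fun x => projIcc 0 m hm.le x
  set R : ℝ → ℝ := fun y => projIcc 0 T hT0 y
  have hPm : ∀ x, P x ∈ Icc 0 m := fun x => (projIcc 0 m hm.le x).2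
  have hRm : ∀ x, R x ∈ Icc 0 T := fun x => (projIcc 0 T hT0 x).2
  have hPe : ∀ x ∈ Icc 0 m, P x = x := fun x hx => by simp [P, projIcc_of_mem _ hx]
  have hRe : ∀ x ∈ Icc 0 T, R x = x := fun x hx => by simp [R, projIcc_of_mem _ hx]
  have hPc : Continuous P := continuous_subtype_val.comp continuous_projIcc
  have hRc : Continuous R := continuous_subtype_val.comp continuous_projIcc
  have hlt : ∀ x ∈ Icc 0 m, x < 1 := fun x hx => hx.2.trans_lt hm1
  set f : ℝ × ℝ → ℂ := fun z => prufer β (P z.1) (R z.2) (u (P z.1) (R z.2)) (w (P z.1) (R z.2))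
    with hf
  have hfc : Continuous f := by
    have h1 : Continuous fun z : ℝ × ℝ => u (P z.1) (R z.2) :=
      hu.comp (by fun_prop : Continuous fun z : ℝ × ℝ => (P z.1, R z.2))
    have h2 : Continuous fun z : ℝ × ℝ => w (P z.1) (R z.2) :=
      hw.comp (by fun_prop : Continuous fun z : ℝ × ℝ => (P z.1, R z.2))
    have h3 : Continuous (weightAmp β) := by unfold weightAmp; fun_prop
    have h4 : Continuous (weightFreq β) := by unfold weightFreq; fun_prop
    simp only [hf, prufer, Complex.mk_eq_add_mul_I]
    fun_prop
  obtain ⟨L, hL, hexp⟩ := exists_continuous_log hfc fun z =>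
    prufer_ne_zero hβ (hPm _).1 (hlt _ (hPm _)) (hne _ (hPm _) _ (hRm _))
  set Δ : ℝ → ℝ := fun e => (L (e, T)).im - (L (e, 0)).im with hΔ
  have hΔc : Continuous Δ := by fun_prop
  have hderiv : ∀ e ∈ Icc 0 m, ∀ θ ∈ Ioo 0 T, HasDerivAt (fun s => (L (e, s)).im)
      ((⟨(1 + weightAmp β e * Real.cos θ) * (-(1 + 7 * β / (1 + e * Real.cos θ)) * u e θ) -
        weightAmp β e * Real.sin θ / 2 * w e θ + weightAmp β e * Real.cos θ / 2 * u e θ,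
        weightFreq β e * w e θ⟩ : ℂ) / prufer β e θ (u e θ) (w e θ)).im θ := by
    intro e he θ hθ
    have hθ' := Ioo_subset_Icc_self hθ
    have h1 := hasDerivAt_prufer (β := β) (e := e) (hdu e he θ hθ') (hdw e he θ hθ')
    have h2 : HasDerivAt (fun s => f (e, s)) _ θ := h1.congr_of_eventuallyEq (by
      filter_upwards [Ioo_mem_nhds hθ.1 hθ.2] with s hs
      simp only [hf, hPe e he, hRe s (Ioo_subset_Icc_self hs)])
    have h3 := hasDerivAt_of_exp_eq (L := fun s => L (e, s)) (by fun_prop)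
      (fun s => hexp (e, s)) h2
    have h4 := Complex.imCLM.hasFDerivAt.comp_hasDerivAt θ h3
    simpa only [hf, hPe e he, hRe θ hθ', Complex.imCLM_apply, Function.comp_def] using h4
  have hΔ0 : Δ 0 = √(1 + 7 * β) * T := by
    have h0m : (0 : ℝ) ∈ Icc 0 m := ⟨le_rfl, hm.le⟩
    rcases hT0.eq_or_lt with h | h
    · simp [hΔ, ← h]
    · obtain ⟨c, hc, hc'⟩ := exists_hasDerivAt_eq_slope (fun s => (L (0, s)).im) _ h
        (by fun_prop) (hderiv 0 h0m)
      rw [im_prufer_div_zero hβ (hne 0 h0m c (Ioo_subset_Icc_self hc)), weightFreq_zero,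
        eq_div_iff (by linarith)] at hc'
      simp only [hΔ, ← hc', sub_zero]
  have hΔm : weightFreq β m * (1 + weightAmp β m ^ 2 / 2) * T ≤ Δ m := by
    have hmm : m ∈ Icc 0 m := ⟨hm.le, le_rfl⟩
    have hν := weightFreq_pos hβ hm.le hm1
    have hd : ∀ θ ∈ Ioo 0 T, HasDerivAt (fun s => (L (m, s)).im -
        weightFreq β m * comparisonPhase (weightAmp β m) s) _ θ := fun θ hθ =>
      (hderiv m hmm θ hθ).sub
        ((hasDerivAt_comparisonPhase (weightAmp β m) θ).const_mul (weightFreq β m))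
    have hcc : Continuous (comparisonPhase (weightAmp β m)) := continuous_iff_continuousAt.2
      fun θ => (hasDerivAt_comparisonPhase _ θ).continuousAt
    have hmono : MonotoneOn (fun s => (L (m, s)).im -
        weightFreq β m * comparisonPhase (weightAmp β m) s) (Icc 0 T) := by
      refine monotoneOn_of_deriv_nonneg (convex_Icc 0 T) (by fun_prop) ?_ ?_
      · rw [interior_Icc]
        exact fun θ hθ => (hd θ hθ).differentiableAt.differentiableWithinAt
      · rw [interior_Icc]
        intro θ hθ
        rw [(hd θ hθ).deriv, sub_nonneg]
        refine le_trans ?_ (le_im_prufer_div hβ hm.le hm1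
          (hne m hmm θ (Ioo_subset_Icc_self hθ)))
        rw [div_eq_mul_one_div]
        refine mul_le_mul_of_nonneg_left (one_div_ge _ ?_) hν.le
        have h1 := weightAmp_lt_half hβ hm1
        have h2 := weightAmp_nonneg hβ hm.le
        nlinarith [Real.neg_one_le_cos θ]
    have := hmono ⟨le_rfl, hT0⟩ ⟨hT0, le_rfl⟩ hT0
    simp only at this
    have h0 : comparisonPhase (weightAmp β m) 0 = 0 := by simp [comparisonPhase]
    rw [h0, comparisonPhase_nat_mul_pi] at this
    simp only [hΔ]
    linarith
  -- Since `u = 0` and `w = 1` at angle 0, the Prüfer vector starts on the positive real axis, so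
  -- the phase gained determines the sign of `u`.
  have hsign : ∀ e ∈ Icc 0 m, ∃ c > 0, u e T = c * Real.sin (Δ e) := by
    intro e he
    have h0 : R 0 = 0 := hRe 0 ⟨le_rfl, hT0⟩
    have hTT : R T = T := hRe T ⟨hT0, le_rfl⟩
    have e0 := hexp (e, 0)
    have eT := hexp (e, T)
    simp only [hf, hPe e he, h0, hTT] at e0 eT
    have e0re := congrArg Complex.re e0
    have e0im := congrArg Complex.im e0
    have eTim := congrArg Complex.im eT
    rw [Complex.exp_re] at e0re
    rw [Complex.exp_im] at e0im eTim
    simp only [prufer, hu0, hw0, Real.cos_zero, Real.sin_zero, mul_one, mul_zero, add_zero]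
      at e0re e0im eTim
    have hν := weightFreq_pos hβ he.1 (hlt e he)
    have hb := weightAmp_nonneg hβ he.1
    have hs0 : Real.sin (L (e, 0)).im = 0 := by
      rcases mul_eq_zero.1 e0im with h | h
      · exact absurd h (Real.exp_pos _).ne'
      · exact h
    have hc0 : 0 < Real.cos (L (e, 0)).im :=
      pos_of_mul_pos_right (by rw [e0re]; positivity) (Real.exp_pos (L (e, 0)).re).le
    have hsin : Real.sin (L (e, T)).im = Real.sin (Δ e) * Real.cos (L (e, 0)).im := by
      rw [show (L (e, T)).im = Δ e + (L (e, 0)).im by simp [hΔ], Real.sin_add, hs0]; ring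
    refine ⟨Real.exp (L (e, T)).re * Real.cos (L (e, 0)).im / weightFreq β e, by positivity, ?_⟩
    rw [hsin] at eTim
    field_simp
    linarith
  set j : ℤ := ⌊Δ 0 / Real.pi⌋ with hj
  have hj1 : (j : ℝ) * Real.pi ≤ Δ 0 := (le_div_iff₀ hpi).1 (Int.floor_le _)
  have hj2 : Δ 0 < (j + 1) * Real.pi := (div_lt_iff₀ hpi).1 (Int.lt_floor_add_one _)
  have hIVT : ∀ y, Δ 0 < y → y ≤ Δ 0 + 2 * Real.pi → ∃ e ∈ Ioc 0 m, Δ e = y := by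
    intro y h1 h2
    obtain ⟨e, he, hey⟩ := intermediate_value_Icc hm.le hΔc.continuousOn
      (show y ∈ Icc (Δ 0) (Δ m) from ⟨h1.le, by linarith⟩)
    refine ⟨e, ⟨lt_of_le_of_ne he.1 ?_, he.2⟩, hey⟩
    rintro rfl
    linarith
  -- These phases lie in the consecutive intervals from `jπ` to `(j+1)π` and from `(j+1)π` to
  -- `(j+2)π`. Both exceed `Δ 0`, which excludes `e = 0`, where `q'` would vanish identically.
  obtain ⟨e₁, he₁, hy₁⟩ := hIVT ((Δ 0 + (j + 1) * Real.pi) / 2) (by linarith) (by linarith)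
  obtain ⟨e₂, he₂, hy₂⟩ := hIVT ((j + 1) * Real.pi + Real.pi / 2) (by linarith) (by linarith)
  obtain ⟨c₁, hc₁, hu₁⟩ := hsign e₁ (Ioc_subset_Icc_self he₁)
  obtain ⟨c₂, hc₂, hu₂⟩ := hsign e₂ (Ioc_subset_Icc_self he₂)
  have hs1 : 0 < Real.sin (Δ e₁ - j * Real.pi) :=
    Real.sin_pos_of_pos_of_lt_pi (by rw [hy₁]; linarith) (by rw [hy₁]; linarith)
  have hs2 : Real.sin (Δ e₂ - j * Real.pi) < 0 := by
    rw [hy₂, show ((j : ℝ) + 1) * Real.pi + Real.pi / 2 - j * Real.pi = Real.pi / 2 + Real.pi by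
      ring, Real.sin_add_pi, Real.sin_pi_div_two]
    norm_num
  rw [Real.sin_sub_int_mul_pi] at hs1 hs2
  rcases Int.even_or_odd j with h | h
  · rw [h.neg_one_zpow, one_mul] at hs1 hs2
    exact ⟨e₂, he₂, e₁, he₁, by rw [hu₂]; exact mul_neg_of_pos_of_neg hc₂ hs2,
      by rw [hu₁]; exact mul_pos hc₁ hs1⟩
  · rw [h.neg_one_zpow] at hs1 hs2
    exact ⟨e₁, he₁, e₂, he₂, by rw [hu₁]; exact mul_neg_of_pos_of_neg hc₁ (by linarith),
      by rw [hu₂]; exact mul_pos hc₂ (by linarith)⟩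

/-- The gap between the mean rates is positive, so the phase lead grows linearly with `k`. -/
theorem exists_nat_phase {β m : ℝ} (hβ : 0 < β) (hm : 0 < m) (hm1 : m < 1) :
    ∃ k : ℕ, 1 ≤ k ∧ √(1 + 7 * β) * (k * Real.pi) + 2 * Real.pi ≤
      weightFreq β m * (1 + weightAmp β m ^ 2 / 2) * (k * Real.pi) := by
  have h := sqrt_lt_weightFreq_mul hβ hm hm1
  set A := weightFreq β m * (1 + weightAmp β m ^ 2 / 2)
  obtain ⟨k, hk⟩ := exists_nat_gt (2 / (A - √(1 + 7 * β)))
  have hA : 0 < A - √(1 + 7 * β) := by linarith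
  refine ⟨k, ?_, ?_⟩
  · have : (0 : ℝ) < k := lt_trans (by positivity) hk
    exact_mod_cast this
  · have := (div_lt_iff₀ hA).1 hk
    nlinarith [Real.pi_pos]

/-! ### Closing the orbit at a rational angle. -/

/-- The zero of a strictly decreasing function depends continuously on parameters. -/
theorem continuousOn_zero_of_strictAnti {X : Type*} [TopologicalSpace X] {S : Set X} {a b : ℝ}
    {g : X → ℝ → ℝ} (hg : Continuous fun z : X × ℝ => g z.1 z.2)
    (hanti : ∀ x ∈ S, StrictAntiOn (g x) (Icc a b)) {Θ : X → ℝ}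
    (hΘ : ∀ x ∈ S, Θ x ∈ Ioo a b ∧ g x (Θ x) = 0) : ContinuousOn Θ S := by
  have hgy : ∀ y, Continuous fun x => g x y := fun y =>
    hg.comp (by fun_prop : Continuous fun x : X => (x, y))
  intro x hx
  obtain ⟨⟨h1, h2⟩, h0⟩ := hΘ x hx
  refine tendsto_order.2 ⟨fun y hy => ?_, fun y hy => ?_⟩
  · obtain ⟨y', hy1, hy2⟩ := exists_between (max_lt hy h1)
    have hya : a < y' := (le_max_right _ _).trans_lt hy1
    have hpos : 0 < g x y' := by
      rw [← h0]; exact hanti x hx ⟨hya.le, by linarith⟩ ⟨h1.le, h2.le⟩ hy2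
    filter_upwards [(hgy y').continuousWithinAt.eventually (lt_mem_nhds hpos),
      self_mem_nhdsWithin] with s hs hsS
    refine ((le_max_left _ _).trans_lt hy1).trans ?_
    by_contra! h
    have := (hanti s hsS).antitoneOn (Ioo_subset_Icc_self (hΘ s hsS).1)
      ⟨hya.le, by linarith⟩ h
    rw [(hΘ s hsS).2] at this
    linarith
  · obtain ⟨y', hy1, hy2⟩ := exists_between (lt_min hy h2)
    have hyb : y' < b := hy2.trans_le (min_le_right _ _)
    have hneg : g x y' < 0 := by
      rw [← h0]; exact hanti x hx ⟨h1.le, h2.le⟩ ⟨by linarith, hyb.le⟩ hy1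
    filter_upwards [(hgy y').continuousWithinAt.eventually (gt_mem_nhds hneg),
      self_mem_nhdsWithin] with s hs hsS
    refine lt_trans ?_ (hy2.trans_le (min_le_left _ _))
    by_contra! h
    have := (hanti s hsS).antitoneOn ⟨by linarith, hyb.le⟩
      (Ioo_subset_Icc_self (hΘ s hsS).1) h
    rw [(hΘ s hsS).2] at this
    linarith

/-- For arbitrarily small amplitudes, some member of the family closes up at an angle that is a
rational multiple of `π`. -/
theorem exists_closed_orbit {β m d c N d' : ℝ} {k : ℕ} {q p u w : ℝ → ℝ → ℝ → ℝ} (hβ : 0 < β)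
    (hm : 0 < m) (hm1 : m < 1) (hd : 0 < d) (hd' : 0 < d') (hk1 : 1 ≤ k)
    (hk : √(1 + 7 * β) * (k * Real.pi) + 2 * Real.pi ≤
      weightFreq β m * (1 + weightAmp β m ^ 2 / 2) * (k * Real.pi))
    (fam : IsReducedFamily β m (k * Real.pi + 1) d c N q p u w) :
    ∃ e ∈ Ioc 0 m, ∃ ε ∈ Ioc 0 (min d d'), ∃ Θ ∈ Ioc 0 (k * Real.pi + 1),
      p e ε Θ = 0 ∧ u e ε Θ = 0 ∧ ∃ r : ℚ, Θ = r * Real.pi := by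
  have hpi3 := Real.pi_gt_three
  have hk1' : (1 : ℝ) ≤ k := by exact_mod_cast hk1
  have hkpi : 3 < k * Real.pi := by nlinarith
  set κ : ℝ := k * Real.pi with hκ
  have hd0 : (0 : ℝ) ∈ Icc 0 d := ⟨le_rfl, hd.le⟩
  obtain ⟨e₁, he₁, e₂, he₂, hu₁, hu₂⟩ := exists_sign_change hβ hm hm1 hk
    (u := fun e => u e 0) (w := fun e => w e 0)
    (fam.cont_u.comp (by fun_prop : Continuous fun z : ℝ × ℝ => (z.1, (0 : ℝ), z.2)))
    (fam.cont_w.comp (by fun_prop : Continuous fun z : ℝ × ℝ => (z.1, (0 : ℝ), z.2)))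
    (fun e => fam.u_zero e 0) (fun e => fam.w_zero e 0)
    (fun e he θ hθ => (fam.reduced e he 0 hd0 θ ⟨hθ.1, by linarith [hθ.2]⟩).deriv_u)
    (fun e he θ hθ => by
      have hθ' : θ ∈ Icc 0 (κ + 1) := ⟨hθ.1, by linarith [hθ.2]⟩
      refine (fam.reduced e he 0 hd0 θ hθ').deriv_w.congr_deriv ?_
      rw [fam.kepler_q e he θ hθ', zero_mul, shape_zero]
      ring)
  set E : ℝ → ℝ := fun x => (1 - x) * e₁ + x * e₂ with hE
  have hEc : Continuous E := by fun_prop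
  have hEm : ∀ x ∈ Icc (0 : ℝ) 1, E x ∈ Ioc 0 m := by
    intro x hx
    have : E x ∈ Ioc 0 m := (convex_Ioc 0 m) he₁ he₂ (by linarith [hx.2]) hx.1 (by ring)
    exact this
  have hEm' := fun x hx => Ioc_subset_Icc_self (hEm x hx)
  -- This sign makes `σ * p` equal to `-e sin(θ - κ)` at `ε = 0`, decreasing through its zero at `κ
  -- = kπ` whatever the parity of `k`.
  set σ : ℝ := (-1) ^ k with hσ
  have hσσ : σ * σ = 1 := by rw [hσ, ← mul_pow]; norm_num
  have hcos : ∀ θ, σ * Real.cos θ = Real.cos (θ - κ) := fun θ =>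
    (Real.cos_sub_nat_mul_pi θ k).symm
  have hsin : ∀ θ, σ * Real.sin θ = Real.sin (θ - κ) := fun θ =>
    (Real.sin_sub_nat_mul_pi θ k).symm
  have hcos1 : 0 < Real.cos 1 := Real.cos_one_pos
  have hsin1 : 0 < Real.sin 1 := Real.sin_pos_of_pos_of_lt_pi one_pos (by linarith)
  have hI : ∀ θ ∈ Icc (κ - 1) (κ + 1), θ ∈ Icc 0 (κ + 1) := fun θ hθ =>
    ⟨by linarith [hθ.1], hθ.2⟩
  have hcq : ∀ {X : Type} [TopologicalSpace X] {a b c : X → ℝ}, Continuous a → Continuous b →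
      Continuous c → Continuous fun x => q (a x) (b x) (c x) := fun ha hb hc =>
    fam.cont_q.comp (ha.prodMk (hb.prodMk hc))
  have hcp : ∀ {X : Type} [TopologicalSpace X] {a b c : X → ℝ}, Continuous a → Continuous b →
      Continuous c → Continuous fun x => p (a x) (b x) (c x) := fun ha hb hc =>
    fam.cont_p.comp (ha.prodMk (hb.prodMk hc))
  have hcu : ∀ {X : Type} [TopologicalSpace X] {a b c : X → ℝ}, Continuous a → Continuous b →
      Continuous c → Continuous fun x => u (a x) (b x) (c x) := fun ha hb hc =>
    fam.cont_u.comp (ha.prodMk (hb.prodMk hc))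
  have hsc : Continuous shape := contDiff_shape.continuous
  -- At `ε = 0` this function is `e cos(θ - κ)`, at least `e cos 1` on the window. Hence `σ * p`
  -- stays strictly decreasing there for small `ε`.
  obtain ⟨d₁, hd₁, hA⟩ := exists_forall_pos_of_pos
    (K := (Icc 0 1 ×ˢ Icc (κ - 1) (κ + 1) : Set (ℝ × ℝ))) (isCompact_Icc.prod isCompact_Icc)
    (f := fun z ε => -σ * (-q (E z.1) ε z.2 + β + (1 - β) * shape (ε * u (E z.1) ε z.2)))
    (by
      have h1 : Continuous fun z : (ℝ × ℝ) × ℝ => q (E z.1.1) z.2 z.1.2 :=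
        hcq (by fun_prop) (by fun_prop) (by fun_prop)
      have h2 : Continuous fun z : (ℝ × ℝ) × ℝ => u (E z.1.1) z.2 z.1.2 :=
        hcu (by fun_prop) (by fun_prop) (by fun_prop)
      fun_prop)
    (by
      rintro ⟨x, θ⟩ ⟨hx, hθ⟩
      simp only
      rw [fam.kepler_q _ (hEm' x hx) θ (hI θ hθ), zero_mul, shape_zero,
        show -σ * (-(1 + E x * Real.cos θ) + β + (1 - β) * 1) = E x * (σ * Real.cos θ) by ring,
        hcos]
      refine mul_pos (hEm x hx).1 (hcos1.trans_le ?_)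
      rw [← Real.cos_abs (θ - κ)]
      exact Real.cos_le_cos_of_nonneg_of_le_pi (abs_nonneg _) (by linarith)
        (abs_le.2 ⟨by linarith [hθ.1], by linarith [hθ.2]⟩))
  obtain ⟨d₂, hd₂, hB⟩ := exists_forall_pos_of_pos (K := (Icc 0 1 : Set ℝ)) isCompact_Icc
    (f := fun x ε => min (σ * p (E x) ε (κ - 1)) (-(σ * p (E x) ε (κ + 1))))
    (by
      have h1 : Continuous fun z : ℝ × ℝ => p (E z.1) z.2 (κ - 1) :=
        hcp (by fun_prop) (by fun_prop) (by fun_prop)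
      have h2 : Continuous fun z : ℝ × ℝ => p (E z.1) z.2 (κ + 1) :=
        hcp (by fun_prop) (by fun_prop) (by fun_prop)
      fun_prop)
    (by
      intro x hx
      have hEx := (hEm x hx).1
      rw [fam.kepler_p _ (hEm' x hx) _ ⟨by linarith, by linarith⟩,
        fam.kepler_p _ (hEm' x hx) _ ⟨by linarith, le_rfl⟩,
        show σ * -(E x * Real.sin (κ - 1)) = -(E x * (σ * Real.sin (κ - 1))) by ring,
        show σ * -(E x * Real.sin (κ + 1)) = -(E x * (σ * Real.sin (κ + 1))) by ring,
        hsin, hsin, show κ - 1 - κ = -1 by ring, show κ + 1 - κ = 1 by ring, Real.sin_neg]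
      have := mul_pos hEx hsin1
      exact lt_min (by linarith) (by linarith))
  set D := min (min d d') (min d₁ d₂) with hD
  have hD0 : 0 < D := lt_min (lt_min hd hd') (lt_min hd₁ hd₂)
  have hDd : D ≤ d := (min_le_left _ _).trans (min_le_left _ _)
  have hD1 : D ≤ d₁ := (min_le_right _ _).trans (min_le_left _ _)
  have hD2 : D ≤ d₂ := (min_le_right _ _).trans (min_le_right _ _)
  set S : Set (ℝ × ℝ) := Icc 0 1 ×ˢ Icc 0 D with hS
  set g : ℝ × ℝ → ℝ → ℝ := fun z θ => σ * p (E z.1) z.2 θ with hg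
  have hgc : Continuous fun z : (ℝ × ℝ) × ℝ => g z.1 z.2 :=
    continuous_const.mul (hcp (by fun_prop) (by fun_prop) (by fun_prop))
  have hanti : ∀ z ∈ S, StrictAntiOn (g z) (Icc (κ - 1) (κ + 1)) := by
    rintro ⟨x, ε⟩ ⟨hx, hε⟩
    have hgd : ∀ θ ∈ Icc (κ - 1) (κ + 1), HasDerivAt (g (x, ε))
        (σ * (-q (E x) ε θ + β + (1 - β) * shape (ε * u (E x) ε θ))) θ := fun θ hθ =>
      (fam.reduced _ (hEm' x hx) ε ⟨hε.1, hε.2.trans hDd⟩ θ (hI θ hθ)).deriv_p.const_mul σ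
    refine strictAntiOn_of_deriv_neg (convex_Icc _ _)
      (fun θ hθ => (hgd θ hθ).continuousAt.continuousWithinAt) fun θ hθ => ?_
    have hθ' := interior_subset hθ
    rw [(hgd θ hθ').deriv]
    have := hA ε ⟨hε.1, hε.2.trans hD1⟩ (x, θ) ⟨hx, hθ'⟩
    linarith
  have hzero : ∀ z : ℝ × ℝ, ∃ θ, z ∈ S → θ ∈ Ioo (κ - 1) (κ + 1) ∧ g z θ = 0 := by
    intro z
    by_cases hz : z ∈ S
    · have h := lt_min_iff.1 (hB z.2 ⟨hz.2.1, hz.2.2.trans hD2⟩ z.1 hz.1)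
      have hgz : Continuous (g z) := hgc.comp (by fun_prop : Continuous fun θ : ℝ => (z, θ))
      obtain ⟨θ, hθ, hθ0⟩ := intermediate_value_Ioo' (by linarith : κ - 1 ≤ κ + 1)
        hgz.continuousOn (show (0 : ℝ) ∈ Ioo (g z (κ + 1)) (g z (κ - 1)) from
          ⟨by simp only [hg]; linarith [h.2], h.1⟩)
      exact ⟨θ, fun _ => ⟨hθ, hθ0⟩⟩
    · exact ⟨0, fun h => absurd h hz⟩
  choose Θ hΘ using hzero
  have hΘc : ContinuousOn Θ S := continuousOn_zero_of_strictAnti hgc hanti hΘ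
  have hΘ0 : ∀ x ∈ Icc (0 : ℝ) 1, Θ (x, 0) = κ := by
    intro x hx
    have hz : (x, (0 : ℝ)) ∈ S := ⟨hx, le_rfl, hD0.le⟩
    refine (hanti _ hz).injOn (Ioo_subset_Icc_self (hΘ _ hz).1) ⟨by linarith, by linarith⟩ ?_
    rw [(hΘ _ hz).2]
    simp only [hg]
    rw [fam.kepler_p _ (hEm' x hx) κ ⟨by linarith, by linarith⟩, hκ, Real.sin_nat_mul_pi]
    ring
  set G : ℝ × ℝ → ℝ := fun z => u (E z.1) z.2 (Θ z) with hG
  have hGc : ContinuousOn G S :=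
    fam.cont_u.comp_continuousOn (f := fun z : ℝ × ℝ => (E z.1, z.2, Θ z))
      ((hEc.comp continuous_fst).continuousOn.prodMk (continuousOn_snd.prodMk hΘc))
  have hG1 : G (0, 0) < 0 := by
    simp only [hG]
    rw [hΘ0 0 ⟨le_rfl, zero_le_one⟩]
    simpa [hE] using hu₁
  have hG2 : 0 < G (1, 0) := by
    simp only [hG]
    rw [hΘ0 1 ⟨zero_le_one, le_rfl⟩]
    simpa [hE] using hu₂
  have hslice : ∀ x ∈ Icc (0 : ℝ) 1, ContinuousWithinAt (fun y => G (x, y)) (Icc 0 D) 0 :=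
    fun x hx => (hGc.comp (f := fun y : ℝ => (x, y)) (by fun_prop) fun y hy => ⟨hx, hy⟩) 0
      ⟨le_rfl, hD0.le⟩
  have hev : ∀ᶠ y in 𝓝[Icc 0 D] (0 : ℝ), G (0, y) < 0 ∧ 0 < G (1, y) :=
    ((hslice 0 ⟨le_rfl, zero_le_one⟩).eventually (gt_mem_nhds hG1)).and
      ((hslice 1 ⟨zero_le_one, le_rfl⟩).eventually (lt_mem_nhds hG2))
  obtain ⟨r, hr, hball⟩ := Metric.mem_nhdsWithin_iff.1 hev
  set D' := min D (r / 2) with hD'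
  have hD'0 : 0 < D' := lt_min hD0 (by positivity)
  have hD'D : D' ≤ D := min_le_left _ _
  have hsub : (Icc 0 1 ×ˢ Icc 0 D' : Set (ℝ × ℝ)) ⊆ S :=
    prod_mono le_rfl (Icc_subset_Icc le_rfl hD'D)
  have hmem : ∀ y ∈ Icc 0 D', G (0, y) < 0 ∧ 0 < G (1, y) := by
    intro y hy
    refine hball ⟨?_, hy.1, hy.2.trans hD'D⟩
    rw [Metric.mem_ball, Real.dist_eq, sub_zero, abs_of_nonneg hy.1]
    have : D' ≤ r / 2 := min_le_right _ _
    linarith [hy.2]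
  obtain ⟨x, hx, y, hy, hGxy, s, hs⟩ := exists_zero_rational hD'0 (G := G)
    (H := fun z => Θ z - κ) (hGc.mono hsub) ((hΘc.mono hsub).sub continuousOn_const)
    (fun y hy => (hmem y hy).1) (fun y hy => (hmem y hy).2)
    (fun x hx => by rw [hΘ0 x hx, sub_self])
  have hz : (x, y) ∈ S := hsub ⟨hx, hy.1.le, hy.2⟩
  obtain ⟨hΘI, hΘp⟩ := hΘ _ hz
  refine ⟨E x, hEm x hx, y, ⟨hy.1, (hy.2.trans hD'D).trans (min_le_left _ _)⟩, Θ (x, y),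
    ⟨by linarith [hΘI.1], hΘI.2.le⟩, ?_, hGxy, s + k, ?_⟩
  · have : σ * (σ * p (E x) y (Θ (x, y))) = 0 := by
      rw [show σ * p (E x) y (Θ (x, y)) = 0 from hΘp, mul_zero]
    rwa [← mul_assoc, hσσ, one_mul] at this
  · push_cast
    rw [add_mul, ← hs, hκ]
    ring

/-! ### Return to time and to motions in space. -/

/-- The angle as a function of time: the solution of `ϑ' = F(ϑ)` for a positive periodic `F`. -/
theorem exists_angle {F : ℝ → ℝ} {K L : ℝ≥0} {δ P : ℝ} (hF : LipschitzWith K F)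
    (hL : ∀ x, ‖F x‖ ≤ L) (hδ : 0 < δ) (hδF : ∀ x, δ ≤ F x) (hP : 0 < P)
    (hper : Function.Periodic F P) :
    ∃ ϑ : ℝ → ℝ, ϑ 0 = 0 ∧ (∀ t, HasDerivAt ϑ (F (ϑ t)) t) ∧
      ∃ T > 0, ∀ t, ϑ (t + T) = ϑ t + P := by
  obtain ⟨ϑ, h0, hϑ⟩ := exists_global_solution hF hL 0
  have hc : Continuous ϑ := continuous_iff_continuousAt.2 fun t => (hϑ t).continuousAt
  have hmono : Monotone fun t => ϑ t - δ * t := by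
    have hd : ∀ t, HasDerivAt (fun t => ϑ t - δ * t) (F (ϑ t) - δ) t := fun t =>
      ((hϑ t).sub ((hasDerivAt_id t).const_mul δ)).congr_deriv (by simp)
    refine monotone_of_deriv_nonneg (fun t => (hd t).differentiableAt) fun t => ?_
    rw [(hd t).deriv]
    linarith [hδF (ϑ t)]
  have hPδ : 0 < P / δ := by positivity
  have hge : P ≤ ϑ (P / δ) := by
    have := hmono hPδ.le
    simp only [h0, mul_zero, sub_zero] at this
    rw [mul_div_cancel₀ _ hδ.ne'] at this
    linarith
  obtain ⟨T, hT, hTP⟩ := intermediate_value_Icc hPδ.le hc.continuousOn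
    (show P ∈ Icc (ϑ 0) (ϑ (P / δ)) from ⟨by rw [h0]; exact hP.le, hge⟩)
  have hT0 : 0 < T := lt_of_le_of_ne hT.1 (by rintro rfl; linarith)
  refine ⟨ϑ, h0, hϑ, T, hT0, fun t => ?_⟩
  have h1 : ∀ t, HasDerivAt (fun t => ϑ (t + T) - P) (F (ϑ (t + T) - P)) t := fun t => by
    rw [hper.sub_eq]
    exact ((hϑ (t + T)).comp_add_const t T).sub_const P
  -- `T` is a time at which the angle equals `P`; periodicity of `F` makes the shifted curve another
  -- solution from 0.
  have := congrFun (solution_unique hF h1 hϑ (by simp [hTP, h0])) t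
  linarith

theorem hasDerivAt_vec3 {f g h : ℝ → ℝ} {f' g' h' t : ℝ} (hf : HasDerivAt f f' t)
    (hg : HasDerivAt g g' t) (hh : HasDerivAt h h' t) :
    HasDerivAt (fun s => (!₂[f s, g s, h s] : Space)) !₂[f', g', h'] t := by
  have hpi : HasDerivAt (fun s => ![f s, g s, h s]) ![f', g', h'] t := by
    rw [hasDerivAt_pi]
    intro i
    fin_cases i <;> simpa
  exact ((PiLp.continuousLinearEquiv 2 ℝ (fun _ : Fin 3 => ℝ)).symm.hasFDerivAt.comp_hasDerivAt
    t hpi)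

theorem norm_vec3 (a b c : ℝ) : ‖(!₂[a, b, c] : Space)‖ = √(a ^ 2 + b ^ 2 + c ^ 2) := by
  rw [EuclideanSpace.norm_eq]
  simp [Fin.sum_univ_three]

theorem hasAccelAt_of_hasDerivAt {x v : ℝ → Space} {a a' : Space} {t : ℝ}
    (hx : ∀ s, HasDerivAt x (v s) s) (hv : HasDerivAt v a t) (h : a' = a) : HasAccelAt x a' t :=
  ⟨(hx t).differentiableAt, by rwa [funext fun s => (hx s).deriv, h]⟩

/-- The motion with `y` at the distance `μ² / q` from the axis at the angle `ϑ`, and with `x` at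
the height `ε μ² u / q` above the pair. -/
noncomputable def isoscelesMotion (m₁ m₂ ε μ : ℝ) (q u ϑ : ℝ → ℝ) : Motion :=
  (fun t => !₂[0, 0, 2 * m₂ / (m₁ + 2 * m₂) * (ε * μ ^ 2 * (u (ϑ t) / q (ϑ t)))],
   fun t => !₂[μ ^ 2 * (Real.cos (ϑ t) / q (ϑ t)), μ ^ 2 * (Real.sin (ϑ t) / q (ϑ t)),
     -(m₁ / (m₁ + 2 * m₂) * (ε * μ ^ 2 * (u (ϑ t) / q (ϑ t))))],
   fun t => !₂[-(μ ^ 2 * (Real.cos (ϑ t) / q (ϑ t))), -(μ ^ 2 * (Real.sin (ϑ t) / q (ϑ t))),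
     -(m₁ / (m₁ + 2 * m₂) * (ε * μ ^ 2 * (u (ϑ t) / q (ϑ t))))])

section Derivatives

variable {β ε κ : ℝ} {q p u w ϑ : ℝ → ℝ}

theorem hasDerivAt_cos_div (hred : ∀ θ, IsReducedAt β ε q p u w θ)
    (hϑ : ∀ t, HasDerivAt ϑ (κ * q (ϑ t) ^ 2) t) (t : ℝ) :
    HasDerivAt (fun t => Real.cos (ϑ t) / q (ϑ t))
      (-κ * (Real.sin (ϑ t) * q (ϑ t) + Real.cos (ϑ t) * p (ϑ t))) t := by
  have hq := (hred (ϑ t)).pos.ne'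
  refine (((Real.hasDerivAt_cos (ϑ t)).div (hred (ϑ t)).deriv_q hq).comp t (hϑ t)).congr_deriv ?_
  field_simp
  ring

theorem hasDerivAt_sin_div (hred : ∀ θ, IsReducedAt β ε q p u w θ)
    (hϑ : ∀ t, HasDerivAt ϑ (κ * q (ϑ t) ^ 2) t) (t : ℝ) :
    HasDerivAt (fun t => Real.sin (ϑ t) / q (ϑ t))
      (κ * (Real.cos (ϑ t) * q (ϑ t) - Real.sin (ϑ t) * p (ϑ t))) t := by
  have hq := (hred (ϑ t)).pos.ne'
  refine (((Real.hasDerivAt_sin (ϑ t)).div (hred (ϑ t)).deriv_q hq).comp t (hϑ t)).congr_deriv ?_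
  field_simp

theorem hasDerivAt_u_div (hred : ∀ θ, IsReducedAt β ε q p u w θ)
    (hϑ : ∀ t, HasDerivAt ϑ (κ * q (ϑ t) ^ 2) t) (t : ℝ) :
    HasDerivAt (fun t => u (ϑ t) / q (ϑ t))
      (κ * (w (ϑ t) * q (ϑ t) - u (ϑ t) * p (ϑ t))) t := by
  have hq := (hred (ϑ t)).pos.ne'
  refine (((hred (ϑ t)).deriv_u.div (hred (ϑ t)).deriv_q hq).comp t (hϑ t)).congr_deriv ?_
  field_simp

/-- The `-q` in `p'` cancels the centrifugal term, leaving a central force. -/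
theorem hasDerivAt_cos_div' (hred : ∀ θ, IsReducedAt β ε q p u w θ)
    (hϑ : ∀ t, HasDerivAt ϑ (κ * q (ϑ t) ^ 2) t) (t : ℝ) :
    HasDerivAt (fun t => -κ * (Real.sin (ϑ t) * q (ϑ t) + Real.cos (ϑ t) * p (ϑ t)))
      (-κ ^ 2 * q (ϑ t) ^ 2 * Real.cos (ϑ t) * (β + (1 - β) * shape (ε * u (ϑ t)))) t := by
  have h := hred (ϑ t)
  refine (((((Real.hasDerivAt_sin (ϑ t)).mul h.deriv_q).add
    ((Real.hasDerivAt_cos (ϑ t)).mul h.deriv_p)).const_mul (-κ)).comp t (hϑ t)).congr_deriv ?_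
  ring

theorem hasDerivAt_sin_div' (hred : ∀ θ, IsReducedAt β ε q p u w θ)
    (hϑ : ∀ t, HasDerivAt ϑ (κ * q (ϑ t) ^ 2) t) (t : ℝ) :
    HasDerivAt (fun t => κ * (Real.cos (ϑ t) * q (ϑ t) - Real.sin (ϑ t) * p (ϑ t)))
      (-κ ^ 2 * q (ϑ t) ^ 2 * Real.sin (ϑ t) * (β + (1 - β) * shape (ε * u (ϑ t)))) t := by
  have h := hred (ϑ t)
  refine (((((Real.hasDerivAt_cos (ϑ t)).mul h.deriv_q).sub
    ((Real.hasDerivAt_sin (ϑ t)).mul h.deriv_p)).const_mul κ).comp t (hϑ t)).congr_deriv ?_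
  ring

/-- The coefficients of `shape` add up to `8β + (1 - β) = 1 + 7β`, and the terms without `shape`
cancel. -/
theorem hasDerivAt_u_div' (hred : ∀ θ, IsReducedAt β ε q p u w θ)
    (hϑ : ∀ t, HasDerivAt ϑ (κ * q (ϑ t) ^ 2) t) (t : ℝ) :
    HasDerivAt (fun t => κ * (w (ϑ t) * q (ϑ t) - u (ϑ t) * p (ϑ t)))
      (-κ ^ 2 * q (ϑ t) ^ 2 * u (ϑ t) * ((1 + 7 * β) * shape (ε * u (ϑ t)))) t := by
  have h := hred (ϑ t)
  have hq := h.pos.ne'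
  refine ((((h.deriv_w.mul h.deriv_q).sub (h.deriv_u.mul h.deriv_p)).const_mul κ).comp t
    (hϑ t)).congr_deriv ?_
  field_simp
  ring

end Derivatives

/-- The pull of bodies at distance `ρ √(1 + U²)` and `2 ρ`. -/
theorem pull_eq_of_norm {m ρ U : ℝ} {a b : Space} (h : ‖b - a‖ = ρ * √(1 + U ^ 2)) :
    pull m a b = (m * shape U / ρ ^ 3) • (b - a) := by
  unfold pull shape
  rw [h, mul_pow]
  congr 1
  have := (sqrt_one_add_sq_pos U).ne'
  by_cases hρ : ρ = 0
  · simp [hρ]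
  · field_simp

/-- With A = m₁ + m₂/4 one has Aβ = m₂/4 (the pull of the twin at distance 2r), A(1 - β) = m₁ and
A(1 + 7β) = m₁ + 2m₂ (the relative vertical pull). -/
theorem isSolution_isoscelesMotion {m₁ m₂ ε μ κ β : ℝ} {q p u w ϑ : ℝ → ℝ} (hm₁ : 0 < m₁)
    (hm₂ : 0 < m₂) (hμ : 0 < μ) (hβ : β = m₂ / (4 * m₁ + m₂))
    (hκ : κ ^ 2 = (m₁ + m₂ / 4) / μ ^ 6) (hred : ∀ θ, IsReducedAt β ε q p u w θ)
    (hϑ : ∀ t, HasDerivAt ϑ (κ * q (ϑ t) ^ 2) t) :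
    IsSolution m₁ m₂ (isoscelesMotion m₁ m₂ ε μ q u ϑ).1 (isoscelesMotion m₁ m₂ ε μ q u ϑ).2.1
      (isoscelesMotion m₁ m₂ ε μ q u ϑ).2.2 := by
  have hX := hasDerivAt_cos_div hred hϑ
  have hY := hasDerivAt_sin_div hred hϑ
  have hU := hasDerivAt_u_div hred hϑ
  have hX' := hasDerivAt_cos_div' hred hϑ
  have hY' := hasDerivAt_sin_div' hred hϑ
  have hU' := hasDerivAt_u_div' hred hϑ
  intro t
  have hq := (hred (ϑ t)).pos
  have hM : 0 < m₁ + 2 * m₂ := by positivity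
  have hcs := Real.sin_sq_add_cos_sq (ϑ t)
  set ρ := μ ^ 2 / q (ϑ t) with hρ
  have hρ0 : 0 < ρ := by positivity
  set S := shape (ε * u (ϑ t)) with hS
  have hs0 := sqrt_one_add_sq_pos (ε * u (ϑ t))
  have dyx : ∀ x y h : ℝ, x ^ 2 + y ^ 2 = ρ ^ 2 → h ^ 2 = (ρ * (ε * u (ϑ t))) ^ 2 →
      ‖(!₂[x, y, h] : Space)‖ = ρ * √(1 + (ε * u (ϑ t)) ^ 2) := by
    intro x y h hxy hh
    rw [norm_vec3, hxy, hh, show ρ ^ 2 + (ρ * (ε * u (ϑ t))) ^ 2 =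
      ρ ^ 2 * (1 + (ε * u (ϑ t)) ^ 2) by ring, Real.sqrt_mul (by positivity),
      Real.sqrt_sq hρ0.le]
  have dzy : ∀ x y : ℝ, x ^ 2 + y ^ 2 = (2 * ρ) ^ 2 →
      ‖(!₂[x, y, 0] : Space)‖ = 2 * ρ * √(1 + (0 : ℝ) ^ 2) := by
    intro x y hxy
    rw [norm_vec3, hxy, show (2 * ρ) ^ 2 + (0 : ℝ) ^ 2 = (2 * ρ) ^ 2 by ring,
      Real.sqrt_sq (by positivity)]
    simp
  have hc1 : (μ ^ 2 * (Real.cos (ϑ t) / q (ϑ t))) ^ 2 + (μ ^ 2 * (Real.sin (ϑ t) / q (ϑ t))) ^ 2 =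
      ρ ^ 2 := by
    rw [hρ]
    linear_combination (μ ^ 2 / q (ϑ t)) ^ 2 * hcs
  have hAB : 2 * m₂ / (m₁ + 2 * m₂) + m₁ / (m₁ + 2 * m₂) = 1 := by field_simp; ring
  have hH : ε * μ ^ 2 * (u (ϑ t) / q (ϑ t)) = ρ * (ε * u (ϑ t)) := by rw [hρ]; ring
  have ey : (isoscelesMotion m₁ m₂ ε μ q u ϑ).2.1 t - (isoscelesMotion m₁ m₂ ε μ q u ϑ).1 t =
      !₂[μ ^ 2 * (Real.cos (ϑ t) / q (ϑ t)), μ ^ 2 * (Real.sin (ϑ t) / q (ϑ t)),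
        -(ρ * (ε * u (ϑ t)))] := by
    ext i
    fin_cases i <;> simp [isoscelesMotion]
    rw [hH]
    linear_combination -(ρ * (ε * u (ϑ t))) * hAB
  have ez : (isoscelesMotion m₁ m₂ ε μ q u ϑ).2.2 t - (isoscelesMotion m₁ m₂ ε μ q u ϑ).1 t =
      !₂[-(μ ^ 2 * (Real.cos (ϑ t) / q (ϑ t))), -(μ ^ 2 * (Real.sin (ϑ t) / q (ϑ t))),
        -(ρ * (ε * u (ϑ t)))] := by
    ext i
    fin_cases i <;> simp [isoscelesMotion]
    rw [hH]
    linear_combination -(ρ * (ε * u (ϑ t))) * hAB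
  have eyz : (isoscelesMotion m₁ m₂ ε μ q u ϑ).2.2 t - (isoscelesMotion m₁ m₂ ε μ q u ϑ).2.1 t =
      !₂[-(2 * (μ ^ 2 * (Real.cos (ϑ t) / q (ϑ t)))),
        -(2 * (μ ^ 2 * (Real.sin (ϑ t) / q (ϑ t)))), 0] := by
    ext i
    fin_cases i <;> simp [isoscelesMotion] <;> ring
  have nyx := dyx _ _ _ hc1 (neg_sq (ρ * (ε * u (ϑ t))))
  have nzx := dyx (-(μ ^ 2 * (Real.cos (ϑ t) / q (ϑ t)))) (-(μ ^ 2 * (Real.sin (ϑ t) / q (ϑ t))))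
    _ (by rw [neg_sq, neg_sq]; exact hc1) (neg_sq (ρ * (ε * u (ϑ t))))
  have nzy := dzy (-(2 * (μ ^ 2 * (Real.cos (ϑ t) / q (ϑ t)))))
    (-(2 * (μ ^ 2 * (Real.sin (ϑ t) / q (ϑ t))))) (by linear_combination 4 * hc1)
  rw [← ey] at nyx
  rw [← ez] at nzx
  rw [← eyz] at nzy
  have nxy := nyx
  have nxz := nzx
  have nyz := nzy
  rw [norm_sub_rev] at nxy nxz nyz
  have hne : ∀ {a b : Space} {r U : ℝ}, 0 < r → ‖b - a‖ = r * √(1 + U ^ 2) → a ≠ b := by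
    rintro a b r U hr h rfl
    rw [sub_self, norm_zero] at h
    have := mul_pos hr (sqrt_one_add_sq_pos U)
    linarith
  refine ⟨⟨hne hρ0 nyx, hne hρ0 nzx, hne (by positivity) nzy⟩, ?_, ?_, ?_⟩
  · rw [pull_eq_of_norm nyx, pull_eq_of_norm nzx, ey, ez]
    refine hasAccelAt_of_hasDerivAt
      (fun s => hasDerivAt_vec3 (hasDerivAt_const s (0 : ℝ)) (hasDerivAt_const s (0 : ℝ))
        (((hU s).const_mul (ε * μ ^ 2)).const_mul (2 * m₂ / (m₁ + 2 * m₂))))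
      (hasDerivAt_vec3 (hasDerivAt_const t (0 : ℝ)) (hasDerivAt_const t (0 : ℝ))
        (((hU' t).const_mul (ε * μ ^ 2)).const_mul (2 * m₂ / (m₁ + 2 * m₂)))) ?_
    ext i
    rw [hβ, hρ]
    fin_cases i <;> simp [← hS, hκ]
    field_simp
    ring
  · rw [pull_eq_of_norm nxy, pull_eq_of_norm nzy, ← neg_sub, ey, eyz, shape_zero]
    refine hasAccelAt_of_hasDerivAt
      (fun s => hasDerivAt_vec3 ((hX s).const_mul (μ ^ 2)) ((hY s).const_mul (μ ^ 2))
        (((hU s).const_mul (ε * μ ^ 2)).const_mul (m₁ / (m₁ + 2 * m₂))).fun_neg)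
      (hasDerivAt_vec3 ((hX' t).const_mul (μ ^ 2)) ((hY' t).const_mul (μ ^ 2))
        (((hU' t).const_mul (ε * μ ^ 2)).const_mul (m₁ / (m₁ + 2 * m₂))).fun_neg) ?_
    ext i
    rw [hβ, hρ]
    fin_cases i <;> simp [← hS, hκ] <;> field_simp <;> ring
  · rw [pull_eq_of_norm nxz, pull_eq_of_norm nyz, ← neg_sub, ez, ← neg_sub, eyz, shape_zero]
    refine hasAccelAt_of_hasDerivAt
      (fun s => hasDerivAt_vec3 ((hX s).const_mul (μ ^ 2)).fun_neg
        ((hY s).const_mul (μ ^ 2)).fun_neg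
        (((hU s).const_mul (ε * μ ^ 2)).const_mul (m₁ / (m₁ + 2 * m₂))).fun_neg)
      (hasDerivAt_vec3 ((hX' t).const_mul (μ ^ 2)).fun_neg ((hY' t).const_mul (μ ^ 2)).fun_neg
        (((hU' t).const_mul (ε * μ ^ 2)).const_mul (m₁ / (m₁ + 2 * m₂))).fun_neg) ?_
    ext i
    rw [hβ, hρ]
    fin_cases i <;> simp [← hS, hκ] <;> field_simp <;> ring

theorem lipschitzWith_mul_sq {q p : ℝ → ℝ} {κ N : ℝ} (hκ : 0 ≤ κ) (hN : 0 ≤ N)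
    (hq : ∀ θ, HasDerivAt q (p θ) θ) (hqN : ∀ θ, |q θ| ≤ N) (hpN : ∀ θ, |p θ| ≤ N) :
    LipschitzWith (2 * κ * N * N).toNNReal fun θ => κ * q θ ^ 2 := by
  have hd : ∀ θ, HasDerivAt (fun θ => κ * q θ ^ 2) (2 * κ * q θ * p θ) θ := fun θ => by
    refine (((hq θ).pow 2).const_mul κ).congr_deriv ?_
    simp
    ring
  refine lipschitzWith_of_nnnorm_deriv_le (fun θ => (hd θ).differentiableAt) fun θ => ?_
  rw [← NNReal.coe_le_coe, coe_nnnorm, (hd θ).deriv, Real.coe_toNNReal _ (by positivity),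
    Real.norm_eq_abs, abs_mul, abs_mul, abs_of_nonneg (by positivity : (0 : ℝ) ≤ 2 * κ)]
  have := hqN θ
  have := hpN θ
  gcongr

theorem hasInitialData_isoscelesMotion {m₁ m₂ ε μ κ β e : ℝ} {q p u w ϑ : ℝ → ℝ} (hm₂ : 0 < m₂)
    (hred : ∀ θ, IsReducedAt β ε q p u w θ)
    (hϑ : ∀ t, HasDerivAt ϑ (κ * q (ϑ t) ^ 2) t) (hϑ0 : ϑ 0 = 0) (hq0 : q 0 = 1 + e)
    (hp0 : p 0 = 0) (hu0 : u 0 = 0) (hw0 : w 0 = 1) :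
    HasInitialData m₁ m₂ (μ ^ 2 / (1 + e)) (μ ^ 2 * κ * (1 + e))
      (2 * m₂ / (m₁ + 2 * m₂) * (ε * μ ^ 2 * κ * (1 + e)))
      (isoscelesMotion m₁ m₂ ε μ q u ϑ).1 (isoscelesMotion m₁ m₂ ε μ q u ϑ).2.1
      (isoscelesMotion m₁ m₂ ε μ q u ϑ).2.2 := by
  have hX := hasDerivAt_cos_div hred hϑ 0
  have hY := hasDerivAt_sin_div hred hϑ 0
  have hU := hasDerivAt_u_div hred hϑ 0
  rw [hϑ0, hq0, hp0] at hX hY hU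
  rw [hw0, hu0] at hU
  have hx := hasDerivAt_vec3 (hasDerivAt_const 0 (0 : ℝ)) (hasDerivAt_const 0 (0 : ℝ))
    ((hU.const_mul (ε * μ ^ 2)).const_mul (2 * m₂ / (m₁ + 2 * m₂)))
  have hy := hasDerivAt_vec3 (hX.const_mul (μ ^ 2)) (hY.const_mul (μ ^ 2))
    ((hU.const_mul (ε * μ ^ 2)).const_mul (m₁ / (m₁ + 2 * m₂))).fun_neg
  have hz := hasDerivAt_vec3 (hX.const_mul (μ ^ 2)).fun_neg (hY.const_mul (μ ^ 2)).fun_neg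
    ((hU.const_mul (ε * μ ^ 2)).const_mul (m₁ / (m₁ + 2 * m₂))).fun_neg
  refine ⟨?_, ?_, ?_, hx.deriv.trans ?_, hy.deriv.trans ?_, hz.deriv.trans ?_⟩
  · ext i
    fin_cases i <;> simp [isoscelesMotion, hϑ0, hu0]
  · ext i
    fin_cases i <;> simp [isoscelesMotion, hϑ0, hu0, hq0, div_eq_mul_inv]
  · ext i
    fin_cases i <;> simp [isoscelesMotion, hϑ0, hu0, hq0, div_eq_mul_inv]
  · ext i
    fin_cases i <;> simp
    ring_nf
    simp
  · ext i
    fin_cases i <;> simp <;> field_simp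
  · ext i
    fin_cases i <;> simp <;> field_simp

/-! ### The energy conditions and the infinite set of motions. -/

/-- The energy of the initial data. -/
theorem c₂_eq {m₁ m₂ ε μ κ e : ℝ} (hm₁ : 0 < m₁) (hm₂ : 0 < m₂) (hμ : 0 < μ) (he : 0 < 1 + e)
    (hκ : κ ^ 2 = (m₁ + m₂ / 4) / μ ^ 6) :
    c₂ m₁ m₂ (μ ^ 2 / (1 + e)) (μ ^ 2 * κ * (1 + e))
      (2 * m₂ / (m₁ + 2 * m₂) * (ε * μ ^ 2 * κ * (1 + e))) =
    m₂ * (m₁ + m₂ / 4) / μ ^ 2 * (e ^ 2 - 1 + m₁ / (m₁ + 2 * m₂) * ε ^ 2 * (1 + e) ^ 2) := by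
  have hM : 0 < m₁ + 2 * m₂ := by positivity
  unfold c₂
  have h1 : (μ ^ 2 * κ * (1 + e)) ^ 2 = (m₁ + m₂ / 4) / μ ^ 2 * (1 + e) ^ 2 := by
    rw [mul_pow, mul_pow, hκ]; field_simp
  have h2 : (2 * m₂ / (m₁ + 2 * m₂) * (ε * μ ^ 2 * κ * (1 + e))) ^ 2 =
      (2 * m₂ / (m₁ + 2 * m₂)) ^ 2 * ε ^ 2 * ((m₁ + m₂ / 4) / μ ^ 2 * (1 + e) ^ 2) := by
    rw [← h1]; ring
  rw [h1, h2]
  field_simp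
  ring

/-- With a = 1 - β the right side is a² - 1, while `e²` and the `ε` term are each at most a²/4. -/
theorem energy_bound {m₁ m₂ ε e : ℝ} (hm₁ : 0 < m₁) (hm₂ : 0 < m₂) (he : 0 ≤ e)
    (heb : e ≤ (1 - m₂ / (4 * m₁ + m₂)) / 2) (hε : 0 ≤ ε)
    (hεb : ε ≤ (1 - m₂ / (4 * m₁ + m₂)) / 4) :
    e ^ 2 - 1 + m₁ / (m₁ + 2 * m₂) * ε ^ 2 * (1 + e) ^ 2 <
      -((8 * m₁ * m₂ + m₂ ^ 2) / (4 * m₁ + m₂) ^ 2) := by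
  set a := 1 - m₂ / (4 * m₁ + m₂) with ha
  have ha0 : 0 < a := by
    rw [ha, sub_pos, div_lt_one (by positivity)]; linarith
  have ha1 : a < 1 := by
    have : 0 < m₂ / (4 * m₁ + m₂) := by positivity
    linarith
  have hr : -((8 * m₁ * m₂ + m₂ ^ 2) / (4 * m₁ + m₂) ^ 2) = a ^ 2 - 1 := by
    rw [ha]; field_simp; ring
  have hB : m₁ / (m₁ + 2 * m₂) ≤ 1 := (div_le_one (by positivity)).2 (by linarith)
  have hB0 : 0 < m₁ / (m₁ + 2 * m₂) := by positivity
  have h1 : e ^ 2 ≤ (a / 2) ^ 2 := by gcongr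
  have h2 : ε ^ 2 ≤ (a / 4) ^ 2 := by gcongr
  have h3 : (1 + e) ^ 2 ≤ 2 ^ 2 := by
    have : 1 + e ≤ 2 := by linarith
    gcongr
  have h4 : m₁ / (m₁ + 2 * m₂) * ε ^ 2 * (1 + e) ^ 2 ≤ 1 * (a / 4) ^ 2 * 2 ^ 2 := by gcongr
  rw [hr]
  nlinarith

/-- Periodic motions of the family, with one motion for every length scale `μ²`. -/
theorem exists_periodic_motions {m₁ m₂ : ℝ} (hm₁ : 0 < m₁) (hm₂ : 0 < m₂) :
    ∃ e > 0, ∀ μ > 0, ∃ p : Motion, p ∈ familyB m₁ m₂ ∧ IsPeriodic p ∧ IsNontrivial p ∧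
      p.2.1 0 0 = μ ^ 2 / (1 + e) := by
  set β := m₂ / (4 * m₁ + m₂) with hβ
  have hβ0 : 0 < β := by positivity
  have hβ1 : β < 1 := by rw [hβ, div_lt_one (by positivity)]; linarith
  set m := (1 - β) / 2 with hm
  have hm0 : 0 < m := by rw [hm]; linarith
  have hm1 : m < 1 := by rw [hm]; linarith
  obtain ⟨k, hk1, hk⟩ := exists_nat_phase hβ0 hm0 hm1
  obtain ⟨d, hd, c, hc, N, q, p, u, w, fam⟩ :=
    exists_reducedFamily (T := k * Real.pi + 1) hβ0 hβ1 hm0 hm1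
  obtain ⟨e, he, ε, hε, Θ, hΘ, hpΘ, huΘ, r, hr⟩ := exists_closed_orbit (d' := (1 - β) / 4) hβ0 hm0
    hm1 hd (by linarith) hk1 hk fam
  have he' := Ioc_subset_Icc_self he
  have hε0 : 0 < ε := hε.1
  have hεb : ε ≤ (1 - β) / 4 := hε.2.trans (min_le_right _ _)
  obtain ⟨hred, hbd, hqper, huper⟩ := fam.closed e he' ε
    ⟨hε0.le, hε.2.trans (min_le_left _ _)⟩ Θ hΘ hpΘ huΘ
  have he1 : 0 < 1 + e := by linarith [he.1]
  have hpi := Real.pi_pos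
  have hΘ0 : 0 < Θ := hΘ.1
  -- After `r.den` periods of the shape the pair has made a whole number of turns.
  have hP : (r.den : ℝ) * (2 * Θ) = (r.num : ℝ) * (2 * Real.pi) := by
    have : (r : ℝ) * r.den = r.num := by exact_mod_cast Rat.mul_den_eq_num r
    rw [hr, ← this]; ring
  have hP0 : 0 < (r.den : ℝ) * (2 * Θ) := by
    have : (0 : ℝ) < r.den := by exact_mod_cast r.den_pos
    positivity
  refine ⟨e, he.1, fun μ hμ => ?_⟩
  set κ := √((m₁ + m₂ / 4) / μ ^ 6) with hκ_def
  have hκ0 : 0 < κ := Real.sqrt_pos.2 (by positivity)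
  have hκ : κ ^ 2 = (m₁ + m₂ / 4) / μ ^ 6 := Real.sq_sqrt (by positivity)
  have hcN : ∀ θ, |q e ε θ| ≤ N := fun θ => by
    rw [abs_of_pos (hc.trans_le (hbd θ).1)]; exact (hbd θ).2.1
  have hN : 0 ≤ N := (abs_nonneg _).trans (hcN 0)
  obtain ⟨ϑ, hϑ0, hϑ, T, hT, hϑT⟩ := exists_angle (F := fun θ => κ * q e ε θ ^ 2)
    (L := (κ * N ^ 2).toNNReal) (δ := κ * c ^ 2)
    (lipschitzWith_mul_sq hκ0.le hN (fun θ => (hred θ).deriv_q) hcN fun θ => (hbd θ).2.2)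
    (fun θ => by
      rw [Real.coe_toNNReal _ (by positivity), Real.norm_eq_abs, abs_mul, abs_pow,
        abs_of_pos hκ0]
      have := hcN θ
      gcongr)
    (by positivity)
    (fun θ => by
      have := (hbd θ).1
      gcongr)
    hP0
    (fun θ => by simp only [(hqper.nat_mul r.den) θ])
  have hinit := hasInitialData_isoscelesMotion (m₁ := m₁) (μ := μ) hm₂ hred hϑ hϑ0 (fam.q_zero e ε)
    (fam.p_zero e ε) (fam.u_zero e ε) (fam.w_zero e ε)
  have hb := energy_bound hm₁ hm₂ he'.1 he'.2 hε0.le hεb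
  have hγ : 0 < m₂ * (m₁ + m₂ / 4) := by positivity
  refine ⟨isoscelesMotion m₁ m₂ ε μ (q e ε) (u e ε) ϑ,
    ⟨isSolution_isoscelesMotion hm₁ hm₂ hμ hβ hκ hred hϑ, _, _, _, by positivity, hinit, ?_, ?_, ?_⟩,
    ⟨T, hT, ?_, ?_, ?_⟩, ?_, ?_⟩
  · have : 0 < μ ^ 2 / (1 + e) * (μ ^ 2 * κ * (1 + e)) := by positivity
    exact this.ne'
  · rw [c₂_eq hm₁ hm₂ hμ he1 hκ]
    refine mul_neg_of_pos_of_neg (by positivity) (hb.trans ?_)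
    rw [neg_lt_zero]
    positivity
  · have hc₁ : c₁ (μ ^ 2 / (1 + e)) (μ ^ 2 * κ * (1 + e)) ^ 2 = (m₁ + m₂ / 4) / μ ^ 6 * μ ^ 8 := by
      rw [← hκ]
      unfold c₁
      field_simp
    rw [c₂_eq hm₁ hm₂ hμ he1 hκ, hc₁]
    set X := e ^ 2 - 1 + m₁ / (m₁ + 2 * m₂) * ε ^ 2 * (1 + e) ^ 2
    have h1 : X * (4 * m₁ + m₂) ^ 2 < -(8 * m₁ * m₂ + m₂ ^ 2) := by
      rwa [← neg_div, lt_div_iff₀ (by positivity)] at hb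
    -- The product of energy and squared angular momentum is scale invariant: `μ` cancels.
    have h2 : 16 * (m₂ * (m₁ + m₂ / 4) / μ ^ 2 * X) * ((m₁ + m₂ / 4) / μ ^ 6 * μ ^ 8) =
        m₂ * (X * (4 * m₁ + m₂) ^ 2) := by
      field_simp
      ring
    rw [h2]
    have := mul_lt_mul_of_pos_left h1 hm₂
    linarith
  · intro t
    simp only [isoscelesMotion, hϑT, (hqper.nat_mul r.den) (ϑ t), (huper.nat_mul r.den) (ϑ t)]
  · intro t
    simp only [isoscelesMotion, hϑT, (hqper.nat_mul r.den) (ϑ t), (huper.nat_mul r.den) (ϑ t)]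
    simp only [hP, Real.cos_add_int_mul_two_pi, Real.sin_add_int_mul_two_pi]
  · intro t
    simp only [isoscelesMotion, hϑT, (hqper.nat_mul r.den) (ϑ t), (huper.nat_mul r.den) (ϑ t)]
    simp only [hP, Real.cos_add_int_mul_two_pi, Real.sin_add_int_mul_two_pi]
  · by_contra hno
    simp only [IsNontrivial, not_exists, not_not] at hno
    -- The initial vertical velocity is a positive multiple of `ε`; this is where `ε > 0` is needed.
    have hx : HasDerivAt (fun t => (isoscelesMotion m₁ m₂ ε μ (q e ε) (u e ε) ϑ).1 t 2)
        (2 * m₂ / (m₁ + 2 * m₂) * (ε * μ ^ 2 * (κ * (w e ε (ϑ 0) * q e ε (ϑ 0) -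
          u e ε (ϑ 0) * p e ε (ϑ 0))))) 0 := by
      simpa [isoscelesMotion] using ((hasDerivAt_u_div hred hϑ 0).const_mul
        (ε * μ ^ 2)).const_mul (2 * m₂ / (m₁ + 2 * m₂))
    rw [funext hno, hϑ0, fam.w_zero, fam.q_zero, fam.u_zero, zero_mul, sub_zero, one_mul] at hx
    have h0 := hx.unique (hasDerivAt_const 0 (0 : ℝ))
    have : 0 < 2 * m₂ / (m₁ + 2 * m₂) * (ε * μ ^ 2 * (κ * (1 + e))) := by positivity
    linarith
  · rw [hinit.2.1]
    simp

end ThreeBody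

theorem mainTheorem4 (m₁ m₂ : ℝ) (hm₁ : 0 < m₁) (hm₂ : 0 < m₂) :
    {p : ThreeBody.Motion | p ∈ ThreeBody.familyB m₁ m₂ ∧
      ThreeBody.IsPeriodic p ∧ ThreeBody.IsNontrivial p}.Infinite := by
  obtain ⟨e, he, h⟩ := ThreeBody.exists_periodic_motions hm₁ hm₂
  choose! p hB hper hnt hp using h
  have hpos : ∀ n : ℕ, (0 : ℝ) < n + 1 := fun n => by positivity
  -- The scales `μ = n + 1` give different initial distances `μ² / (1 + e)` with one common `e`.
  refine Set.infinite_of_injective_forall_mem (f := fun n : ℕ => p (n + 1)) (fun a b hab => ?_)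
    fun n => ⟨hB _ (hpos n), hper _ (hpos n), hnt _ (hpos n)⟩
  have h1 := hp _ (hpos a)
  simp only at hab
  rw [hab, hp _ (hpos b), div_left_inj' (by positivity), sq_eq_sq₀ (hpos b).le (hpos a).le] at h1
  have h2 : (b : ℝ) = a := by linarith
  exact_mod_cast h2.symm
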